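/- Let $d\ge 1$. Let $\mathcal D=\{[m2^k,(m+1)2^k): m,k\in\mathbb Z\}$ be the dyadic intervals, $\mathcal D^d$ the dyadic rectangles $R=R_{(1)}\times\cdots\times R_{(d)}$ of $\mathbb R^d$, and for $\mathcal U\subset\mathcal D^d$ let $\mathrm{sh}(\mathcal U)=\bigcup_{R\in\mathcal U}R$. Let $\mathrm M f(x)=\sup_{R\ni x}|R|^{-1}\int_R|f|$ be the strong maximal function, the supremum being over all (not necessarily dyadic) axis-parallel rectangles containing $x$. For $V\subset\mathbb R^d$ and $R\in\mathcal D^d$ put $$\mathrm{emb}(R,V)=\sup\{\mu\ge 1:\ (\mu R_{(1)})\times R_{(2)}\times\cdots\times R_{(d)}\subset V\},$$ where $\mu R_{(1)}$ is the interval with the same center as $R_{(1)}$ and length $\mu|R_{(1)}|$. For $I\in\mathcal D$, an integer $j\ge1$ and $\mathcal U'\subset\mathcal D^d$ put $$F(I,j,\mathcal U')=\bigcup\{R\in\mathcal U':\ R_{(1)}=I,\ 2^{j-1}\le\mathrm{emb}(R,V)<2^j\}.$$ For all $\delta,\epsilon>0$ there are a finite constant $C$ depending only on $d,\delta,\epsilon$,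 and for each $1<p<\infty$ a finite constant $C_p$ depending only on $d,\delta,\epsilon,p$, such that the following holds. For every $\mathcal U\subset\mathcal D^d$ with $|\mathrm{sh}(\mathcal U)|<\infty$ there is a measurable set $V\supset\mathrm{sh}(\mathcal U)$ with $|V|\le(1+\delta)|\mathrm{sh}(\mathcal U)|$ such that, for every $\mathcal U'\subset\mathcal U$, $$\sum_{j=1}^\infty\sum_{I\in\mathcal D}2^{-\epsilon j}|F(I,j,\mathcal U')|\le C\,|\mathrm{sh}(\mathcal U')|,$$ and, for every integer $n>1$ and every $1<p<\infty$, $$\Bigl\|\sum_{j=1}^\infty\sum_{I\in\mathcal D}2^{-\epsilon j}\bigl(\mathrm M\mathbf 1_{F(I,j,\mathcal U')}\bigr)^n\Bigr\|_{L^p(\mathbb R^d)}\le C_p\,|\mathrm{sh}(\mathcal U')|^{1/p}.$$ -/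

import Mathlib

open MeasureTheory Set
open scoped ENNReal NNReal

namespace Journe

noncomputable section

/-- A dyadic interval `[pos * 2 ^ scale, (pos + 1) * 2 ^ scale)`, with `scale, pos ∈ ℤ`. Distinct
pairs `(scale, pos)` give distinct intervals, so this type is the collection `𝒟` itself. -/
@[ext]
structure DyadicInterval where
  scale : ℤ
  pos : ℤ

namespace DyadicInterval

/-- The length of a dyadic interval. -/
def length (I : DyadicInterval) : ℝ := (2 : ℝ) ^ I.scale

/-- The centre of a dyadic interval. -/
def center (I : DyadicInterval) : ℝ := ((I.pos : ℝ) + 1 / 2) * I.length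

/-- The dyadic interval as a set of reals. -/
def toSet (I : DyadicInterval) : Set ℝ :=
  Ico ((I.pos : ℝ) * (2 : ℝ) ^ I.scale) (((I.pos : ℝ) + 1) * (2 : ℝ) ^ I.scale)

/-- The interval `t I`: same centre as `I`, length multiplied by `t`. -/
def dilate (t : ℝ) (I : DyadicInterval) : Set ℝ :=
  Ico (I.center - t * I.length / 2) (I.center + t * I.length / 2)

theorem dilate_one (I : DyadicInterval) : I.dilate 1 = I.toSet := by
  unfold dilate toSet center length
  congr 1 <;> ring

theorem toSet_injective : Function.Injective toSet := by
  rintro ⟨k, m⟩ ⟨k', m'⟩ h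
  have hk : (0 : ℝ) < (2 : ℝ) ^ k := by positivity
  have hk' : (0 : ℝ) < (2 : ℝ) ^ k' := by positivity
  have hlt : (m : ℝ) * (2 : ℝ) ^ k < ((m : ℝ) + 1) * (2 : ℝ) ^ k := by nlinarith
  have hlt' : (m' : ℝ) * (2 : ℝ) ^ k' < ((m' : ℝ) + 1) * (2 : ℝ) ^ k' := by nlinarith
  simp only [toSet] at h
  have h1 : (m : ℝ) * (2 : ℝ) ^ k = (m' : ℝ) * (2 : ℝ) ^ k' := by
    rw [← csInf_Ico hlt, h, csInf_Ico hlt']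
  have h2 : ((m : ℝ) + 1) * (2 : ℝ) ^ k = ((m' : ℝ) + 1) * (2 : ℝ) ^ k' := by
    rw [← csSup_Ico hlt, h, csSup_Ico hlt']
  have h3 : (2 : ℝ) ^ k = (2 : ℝ) ^ k' := by linarith
  have h4 : k = k' := zpow_right_injective₀ (by norm_num) (by norm_num) h3
  subst h4
  have h5 : (m : ℝ) = m' := mul_right_cancel₀ hk.ne' h1
  have h6 : m = m' := by exact_mod_cast h5
  rw [h6]

end DyadicInterval

/-- A dyadic rectangle in `ℝ ^ d`, given by its sides `R i ∈ 𝒟`, `i : Fin d`. -/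
abbrev DyadicRect (d : ℕ) : Type := Fin d → DyadicInterval

variable {d : ℕ}

/-- The dyadic rectangle as a subset of `ℝ ^ d`: the product of its sides. -/
def DyadicRect.toSet (R : DyadicRect d) : Set (Fin d → ℝ) :=
  Set.pi univ fun i => (R i).toSet

/-- The dilated rectangle `∏ i, t i • R i`, each side dilated about its centre. -/
def DyadicRect.dil (t : Fin d → ℝ) (R : DyadicRect d) : Set (Fin d → ℝ) :=
  Set.pi univ fun i => (R i).dilate (t i)

/-- The shadow of a collection of rectangles: the union of its members. -/
def shadow (U : Set (DyadicRect d)) : Set (Fin d → ℝ) :=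
  ⋃ R ∈ U, R.toSet

/-- The open axis-parallel rectangle `∏ i, (a i, b i)`. -/
def box (a b : Fin d → ℝ) : Set (Fin d → ℝ) :=
  Set.pi univ fun i => Ioo (a i) (b i)

/-- The strong maximal function: at `x`, the supremum of the averages of `|f|` over all (not
necessarily dyadic) axis-parallel rectangles containing `x`. It does not matter whether rectangles
are taken open or closed; open ones are used. -/
def strongMaximal (f : (Fin d → ℝ) → ℝ) (x : Fin d → ℝ) : ℝ≥0∞ :=
  ⨆ (a : Fin d → ℝ) (b : Fin d → ℝ) (_ : ∀ i, a i < b i) (_ : x ∈ box a b),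
    (∫⁻ y in box a b, ‖f y‖ₑ ∂volume) / volume (box a b)

/-- Embeddedness of `R` in `V` in the first coordinate:
`sup {μ ≥ 1 | Dil_{(μ, 1, …, 1)} R ⊆ V}`, with values in `[0, ∞]`. -/
def emb [NeZero d] (R : DyadicRect d) (V : Set (Fin d → ℝ)) : ℝ≥0∞ :=
  ⨆ (μ : ℝ) (_ : 1 ≤ μ ∧ R.dil (Function.update 1 0 μ) ⊆ V), ENNReal.ofReal μ

/-- `F(I, j, U')`, for `j ≥ 1`: the union of the rectangles `R ∈ U'` with first side `I` and
`2 ^ (j - 1) ≤ emb R V < 2 ^ j`. -/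
def F [NeZero d] (V : Set (Fin d → ℝ)) (I : DyadicInterval) (j : ℕ) (U' : Set (DyadicRect d)) :
    Set (Fin d → ℝ) :=
  shadow {R | R ∈ U' ∧ R 0 = I ∧ (2 : ℝ≥0∞) ^ (j - 1) ≤ emb R V ∧ emb R V < (2 : ℝ≥0∞) ^ j}

end

end Journe

/-! Let E = sh(U). The set V is `enlarge η (1 + κ) E`. First E is enlarged to the set where the
iterated dyadic maximal function of 1_E, in all coordinates but the first, exceeds 1 - η. Then, on
each line parallel to the first axis, the dyadic intervals filled by this level set up to a null set
are dilated by 1 + κ. For small η the level set has measure at most (1 + κ)|E|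
(`exists_volume_iterMax_le`), and the dilation costs only another factor 1 + κ, because dilates of
nested dyadic intervals are nested.

Let R ∈ U' have first side I, remaining sides R', and 2^(j-1) ≤ emb(R, V) < 2^j. The 2^j-dilate of R
leaves V. Its first side lies in (1 + κ)K, where K is the dyadic ancestor of I that is j + c
generations up and κ 2^c ≥ 1. By the definition of V some slice {t₀} × R' with t₀ ∈ K meets E in
density at most 1 - η. The sets F(J, j, U') with J ⊇ K are unchanged by moving the first coordinate
within K, so their union fills at most the fraction 1 - η of R. Removing it from F(I, j, U') leaves
a core that fills at least the fraction η of every such R (`mul_volume_le_volume_inter_corePart`).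
Hence 1_F ≤ C (M 1_core)^2 pointwise (`indicator_F_le`).

For fixed j, at most j + c cores overlap at a point (`tsum_indicator_corePart_le`), and ∑ 2^(-εj) (j
+ c) converges. The Fefferman–Stein inequality (`vector_valued`) therefore bounds ∑ 2^(-εj) 1_F in
every L^p, p ≥ 1. The case p = 1 is the first claim. The second follows by applying the same
inequality once more, to the functions 1_F themselves.

Fefferman–Stein is derived from the weighted bound ∫ (Mf)^q w ≤ C ∫ f^q Mw on the line, iterated
over the coordinates and dualised against the weight. -/

namespace Journe

/-! ### Maximal functions on the line -/

/-- The uncentred maximal function of `f` on the line, over the sets of the family `S`. -/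
noncomputable def setMax {ι : Type*} (S : ι → Set ℝ) (f : ℝ → ℝ≥0∞) (x : ℝ) : ℝ≥0∞ :=
  ⨆ k, (S k).indicator (fun _ => (∫⁻ t in S k, f t) / volume (S k)) x

/-- The closed intervals with rational centre and radius. -/
def balls (k : ℚ × ℚ) : Set ℝ := Metric.closedBall (k.1 : ℝ) (k.2 : ℝ)

section setMax

variable {ι : Type*} {S : ι → Set ℝ}

theorem lintegral_le_setMax {k : ι} (hk : volume (S k) ≠ ∞) (f : ℝ → ℝ≥0∞) {x : ℝ}
    (hx : x ∈ S k) : ∫⁻ t in S k, f t ≤ volume (S k) * setMax S f x := by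
  by_cases h0 : volume (S k) = 0
  · simp [Measure.restrict_eq_zero.2 h0]
  have h : (∫⁻ t in S k, f t) / volume (S k) ≤ setMax S f x := by
    have := le_iSup (fun k => (S k).indicator (fun _ => (∫⁻ t in S k, f t) / volume (S k)) x) k
    rwa [indicator_of_mem hx] at this
  rw [mul_comm]
  exact (ENNReal.div_le_iff h0 hk).1 h

theorem setMax_mono {f g : ℝ → ℝ≥0∞} (h : f ≤ g) : setMax S f ≤ setMax S g := fun _ =>
  iSup_mono fun _ => indicator_le_indicator (ENNReal.div_le_div_right (lintegral_mono h) _)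

theorem setMax_le {f : ℝ → ℝ≥0∞} {c : ℝ≥0∞} (h : ∀ t, f t ≤ c) (x : ℝ) : setMax S f x ≤ c := by
  refine iSup_le fun k => ?_
  refine indicator_le_self' (fun _ _ => zero_le) _ |>.trans ?_
  refine ENNReal.div_le_of_le_mul ?_
  calc ∫⁻ t in S k, f t ≤ ∫⁻ _ in S k, c := lintegral_mono h
    _ = c * volume (S k) := by simp

theorem setMax_add_le {f g : ℝ → ℝ≥0∞} (hf : Measurable f) (x : ℝ) :
    setMax S (fun t => f t + g t) x ≤ setMax S f x + setMax S g x := by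
  refine iSup_le fun k => ?_
  by_cases hx : x ∈ S k
  · rw [indicator_of_mem hx, lintegral_add_left hf, ENNReal.add_div]
    refine add_le_add ?_ ?_
    · refine le_iSup_of_le k ?_
      rw [indicator_of_mem hx]
    · refine le_iSup_of_le k ?_
      rw [indicator_of_mem hx]
  · simp [indicator_of_notMem hx]

theorem lt_setMax_iff {f : ℝ → ℝ≥0∞} {x : ℝ} {c : ℝ≥0∞} :
    c < setMax S f x ↔ ∃ k, x ∈ S k ∧ c < (∫⁻ t in S k, f t) / volume (S k) := by
  rw [setMax, lt_iSup_iff]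
  refine exists_congr fun k => ?_
  by_cases hx : x ∈ S k <;> simp [hx]

theorem measurable_setMax [Countable ι] (hS : ∀ k, MeasurableSet (S k)) (f : ℝ → ℝ≥0∞) :
    Measurable (setMax S f) :=
  Measurable.iSup fun k => measurable_const.indicator (hS k)

end setMax

/-! ### Weighted weak type inequality on the line -/

theorem measurableSet_balls (k : ℚ × ℚ) : MeasurableSet (balls k) :=
  Metric.isClosed_closedBall.measurableSet

theorem volume_balls (k : ℚ × ℚ) : volume (balls k) = ENNReal.ofReal (2 * (k.2 : ℝ)) :=
  Real.volume_closedBall _ _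

theorem volume_balls_ne_top (k : ℚ × ℚ) : volume (balls k) ≠ ∞ := by
  rw [volume_balls]; exact ENNReal.ofReal_ne_top

/-- Weighted weak type inequality for a family of intervals of bounded length. -/
theorem weak_type_bounded (f w : ℝ → ℝ≥0∞) (c : ℝ≥0∞) (T : Set (ℚ × ℚ)) (M : ℝ)
    (hM : ∀ k ∈ T, (k.2 : ℝ) ≤ M) (hT : ∀ k ∈ T, c < (∫⁻ t in balls k, f t) / volume (balls k)) :
    c * ∫⁻ x in ⋃ k ∈ T, balls k, w x ≤ 5 * ∫⁻ x, f x * setMax balls w x := by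
  obtain ⟨u, huT, hdisj, hcov⟩ := Vitali.exists_disjoint_subfamily_covering_enlargement_closedBall
    T (fun k => (k.1 : ℝ)) (fun k => (k.2 : ℝ)) M hM 5 (by norm_num)
  have hsub : (⋃ k ∈ T, balls k) ⊆ ⋃ k ∈ u, balls (k.1, 5 * k.2) := by
    refine iUnion₂_subset fun k hk => ?_
    obtain ⟨b, hb, h⟩ := hcov k hk
    refine subset_iUnion₂_of_subset b hb ?_
    simpa [balls] using h
  have hone : ∀ k ∈ u, c * ∫⁻ x in balls (k.1, 5 * k.2), w x
      ≤ 5 * ∫⁻ x in balls k, f x * setMax balls w x := by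
    intro k hk
    -- A nonpositive radius gives a null set, whose average is 0 / 0 = 0 and cannot exceed `c`.
    have hpos : (0 : ℝ) < k.2 := by
      by_contra! h
      have h1 := hT k (huT hk)
      have : volume (balls k) = 0 := by
        rw [volume_balls, ENNReal.ofReal_eq_zero]; linarith
      simp [Measure.restrict_eq_zero.2 this] at h1
    have hv5 : volume (balls (k.1, 5 * k.2)) = 5 * volume (balls k) := by
      rw [volume_balls, volume_balls, show (5 : ℝ≥0∞) = ENNReal.ofReal 5 by simp,
        ← ENNReal.ofReal_mul (by norm_num)]
      congr 1; push_cast; ring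
    have hsubk : balls k ⊆ balls (k.1, 5 * k.2) :=
      Metric.closedBall_subset_closedBall (by push_cast; linarith)
    -- The fivefold enlargement again has rational centre and radius, so it belongs to the family
    -- defining the maximal function of `w`.
    have hpt : ∀ x ∈ balls k, ∫⁻ y in balls (k.1, 5 * k.2), w y
        ≤ 5 * volume (balls k) * setMax balls w x := fun x hx => by
      rw [← hv5]
      exact lintegral_le_setMax (volume_balls_ne_top _) w (hsubk hx)
    have hv0 : volume (balls k) ≠ 0 := by
      rw [volume_balls]; simpa using hpos
    have hcI : c * volume (balls k) ≤ ∫⁻ t in balls k, f t :=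
      (ENNReal.le_div_iff_mul_le (Or.inl hv0) (Or.inl (volume_balls_ne_top k))).1
        (hT k (huT hk)).le
    set A := ∫⁻ y in balls (k.1, 5 * k.2), w y with hA
    have key : volume (balls k) * (c * A)
        ≤ volume (balls k) * (5 * ∫⁻ x in balls k, f x * setMax balls w x) := by
      calc volume (balls k) * (c * A) = c * volume (balls k) * A := by ring
        _ ≤ (∫⁻ t in balls k, f t) * A := by gcongr
        _ ≤ ∫⁻ t in balls k, f t * A := lintegral_mul_const_le _ _
        _ ≤ ∫⁻ t in balls k, (5 * volume (balls k)) * (f t * setMax balls w t) := by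
          refine setLIntegral_mono' (measurableSet_balls k) fun t ht => ?_
          calc f t * A ≤ f t * (5 * volume (balls k) * setMax balls w t) := by
                gcongr; exact hpt t ht
            _ = _ := by ring
        _ = 5 * volume (balls k) * ∫⁻ t in balls k, f t * setMax balls w t :=
          lintegral_const_mul' _ _
            (ENNReal.mul_ne_top (by norm_num) (volume_balls_ne_top k))
        _ = _ := by ring
    exact (ENNReal.mul_le_mul_iff_right hv0 (volume_balls_ne_top k)).1 key
  calc c * ∫⁻ x in ⋃ k ∈ T, balls k, w x
      ≤ c * ∫⁻ x in ⋃ k ∈ u, balls (k.1, 5 * k.2), w x := by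
        gcongr
    _ ≤ c * ∑' k : u, ∫⁻ x in balls (k.1.1, 5 * k.1.2), w x := by
        gcongr
        rw [biUnion_eq_iUnion]
        exact lintegral_iUnion_le _ _
    _ = ∑' k : u, c * ∫⁻ x in balls (k.1.1, 5 * k.1.2), w x := ENNReal.tsum_mul_left.symm
    _ ≤ ∑' k : u, 5 * ∫⁻ x in balls k, f x * setMax balls w x :=
        ENNReal.tsum_le_tsum fun k => hone k k.2
    _ = 5 * ∑' k : u, ∫⁻ x in balls k, f x * setMax balls w x := ENNReal.tsum_mul_left
    _ = 5 * ∫⁻ x in ⋃ k : u, balls k, f x * setMax balls w x := by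
        rw [lintegral_iUnion (fun k => measurableSet_balls _)]
        exact (pairwise_subtype_iff_pairwise_set u _).2 hdisj
    _ ≤ 5 * ∫⁻ x, f x * setMax balls w x := by
        exact mul_le_mul_right (setLIntegral_le_lintegral _ _) _

/-- Weighted weak type inequality for the maximal function. -/
theorem weak_type (f w : ℝ → ℝ≥0∞) (c : ℝ≥0∞) :
    c * ∫⁻ x in {x | c < setMax balls f x}, w x ≤ 5 * ∫⁻ x, f x * setMax balls w x := by
  -- The Vitali covering argument needs bounded radii, so the superlevel set is exhausted by radii
  -- at most `n`.
  let T : ℕ → Set (ℚ × ℚ) := fun n =>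
    {k | (k.2 : ℝ) ≤ n ∧ c < (∫⁻ t in balls k, f t) / volume (balls k)}
  have hU : {x | c < setMax balls f x} = ⋃ n, ⋃ k ∈ T n, balls k := by
    ext x
    simp only [mem_ofPred_eq, lt_setMax_iff, mem_iUnion]
    constructor
    · rintro ⟨k, hx, hk⟩
      obtain ⟨n, hn⟩ := exists_nat_ge (k.2 : ℝ)
      exact ⟨n, k, ⟨hn, hk⟩, hx⟩
    · rintro ⟨n, k, hk, hx⟩
      exact ⟨k, hx, hk.2⟩
  have hmono : Monotone fun n => ⋃ k ∈ T n, balls k := by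
    intro n m hnm
    refine biUnion_subset_biUnion_left fun k hk => ⟨hk.1.trans ?_, hk.2⟩
    exact_mod_cast hnm
  rw [hU, setLIntegral_iUnion_of_directed w hmono.directed_le, ENNReal.mul_iSup]
  exact iSup_le fun n => weak_type_bounded f w c (T n) n (fun k hk => hk.1) fun k hk => hk.2

/-! ### From weak type to strong type by the layer cake formula -/

/-- The kernel `t ^ (s - 1)`, cut off at `t = y`, of the layer cake formula for `y ^ s`. -/
noncomputable def powKernel (s : ℝ) (y : ℝ≥0∞) (t : ℝ) : ℝ≥0∞ :=
  {t | ENNReal.ofReal t < y}.indicator (fun t => ENNReal.ofReal (t ^ (s - 1))) t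

theorem powKernel_of_lt {s : ℝ} {y : ℝ≥0∞} {t : ℝ} (h : ENNReal.ofReal t < y) :
    powKernel s y t = ENNReal.ofReal (t ^ (s - 1)) :=
  indicator_of_mem (s := {t | ENNReal.ofReal t < y}) h _

theorem powKernel_of_not_lt {s : ℝ} {y : ℝ≥0∞} {t : ℝ} (h : ¬ ENNReal.ofReal t < y) :
    powKernel s y t = 0 :=
  indicator_of_notMem (s := {t | ENNReal.ofReal t < y}) h _

theorem measurable_powKernel (s : ℝ) {g : ℝ → ℝ≥0∞} (hg : Measurable g) :
    Measurable fun z : ℝ × ℝ => powKernel s (g z.1) z.2 := by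
  have : (fun z : ℝ × ℝ => powKernel s (g z.1) z.2) =
      {z : ℝ × ℝ | ENNReal.ofReal z.2 < g z.1}.indicator
        (fun z => ENNReal.ofReal (z.2 ^ (s - 1))) := by
    ext z; simp only [powKernel, indicator, mem_ofPred_eq]
  rw [this]
  exact Measurable.indicator (by fun_prop) (measurableSet_lt (by fun_prop) (by fun_prop))

theorem measurable_powKernel_right (s : ℝ) (y : ℝ≥0∞) : Measurable (powKernel s y) :=
  Measurable.indicator (by fun_prop) (measurableSet_lt (by fun_prop) measurable_const)

theorem lintegral_powKernel_ofReal {s : ℝ} (hs : 0 < s) {r : ℝ} (hr : 0 ≤ r) :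
    ∫⁻ t in Ioi (0 : ℝ), powKernel s (ENNReal.ofReal r) t = ENNReal.ofReal r ^ s / ENNReal.ofReal s := by
  have hm : MeasurableSet {t : ℝ | ENNReal.ofReal t < ENNReal.ofReal r} :=
    measurableSet_lt ENNReal.measurable_ofReal measurable_const
  have hset : {t : ℝ | ENNReal.ofReal t < ENNReal.ofReal r} ∩ Ioi 0 = Ioo 0 r := by
    ext t
    simp only [mem_inter_iff, mem_ofPred_eq, mem_Ioi, mem_Ioo]
    constructor
    · rintro ⟨h1, h2⟩
      exact ⟨h2, (ENNReal.ofReal_lt_ofReal_iff'.1 h1).1⟩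
    · rintro ⟨h1, h2⟩
      exact ⟨ENNReal.ofReal_lt_ofReal_iff'.2 ⟨h2, h1.trans h2⟩, h1⟩
  simp only [powKernel]
  rw [setLIntegral_indicator hm, hset, restrict_Ioo_eq_restrict_Ioc,
    ← ofReal_integral_eq_lintegral_ofReal, ← intervalIntegral.integral_of_le hr,
    integral_rpow (Or.inl (by linarith)), sub_add_cancel, Real.zero_rpow hs.ne', sub_zero,
    ENNReal.ofReal_div_of_pos hs, ENNReal.ofReal_rpow_of_nonneg hr hs.le]
  · exact (intervalIntegral.intervalIntegrable_rpow' (by linarith)).1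
  · filter_upwards [ae_restrict_mem measurableSet_Ioc] with t ht
    exact Real.rpow_nonneg ht.1.le _

/-- Layer cake formula for a power of a single number. -/
theorem lintegral_powKernel {s : ℝ} (hs : 0 < s) (y : ℝ≥0∞) :
    ∫⁻ t in Ioi (0 : ℝ), powKernel s y t = y ^ s / ENNReal.ofReal s := by
  rcases eq_or_ne y ∞ with rfl | hy
  · rw [ENNReal.top_rpow_of_pos hs, ENNReal.top_div_of_ne_top ENNReal.ofReal_ne_top]
    refine ENNReal.eq_top_of_forall_nnreal_le fun r => ?_
    -- Chosen so that a ^ s / s = r. Cutting the kernel off at `a` shows that the integral is at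
    -- least the arbitrary number `r`.
    set a : ℝ := ((r : ℝ) * s) ^ (1 / s) with ha
    have ha0 : 0 ≤ a := by positivity
    have hpow : ENNReal.ofReal a ^ s / ENNReal.ofReal s = r := by
      rw [ENNReal.ofReal_rpow_of_nonneg ha0 hs.le, ← ENNReal.ofReal_div_of_pos hs, ha,
        ← Real.rpow_mul (by positivity), one_div_mul_cancel hs.ne', Real.rpow_one,
        mul_div_cancel_right₀ _ hs.ne', ENNReal.ofReal_coe_nnreal]
    rw [← hpow, ← lintegral_powKernel_ofReal hs ha0]
    refine lintegral_mono fun t => ?_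
    by_cases ht : ENNReal.ofReal t < ENNReal.ofReal a
    · rw [powKernel_of_lt ht, powKernel_of_lt (ht.trans_le le_top)]
    · rw [powKernel_of_not_lt ht]; exact zero_le
  · rw [← ENNReal.ofReal_toReal hy]
    exact lintegral_powKernel_ofReal hs ENNReal.toReal_nonneg

/-- Weak type inequality for the part of `f` above half the level. -/
theorem weak_type_truncated (f w : ℝ → ℝ≥0∞) (hf : Measurable f) (c : ℝ≥0∞) :
    c / 2 * ∫⁻ x in {x | c < setMax balls f x}, w x
      ≤ 5 * ∫⁻ x, {x | c < 2 * f x}.indicator f x * setMax balls w x := by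
  have hm : MeasurableSet {x | c < 2 * f x} := measurableSet_lt measurable_const (hf.const_mul 2)
  refine le_trans ?_ (weak_type ({x | c < 2 * f x}.indicator f) w (c / 2))
  gcongr _ * ?_
  refine lintegral_mono_set fun x hx => ?_
  by_contra h
  have h : setMax balls ({x | c < 2 * f x}.indicator f) x ≤ c / 2 := not_lt.1 h
  rw [mem_ofPred_eq] at hx
  refine absurd hx (not_lt.2 ?_)
  -- The part of `f` removed by the truncation is at most `c / 2`, and so are its averages.
  calc setMax balls f x
      ≤ setMax balls (fun t => {x | c < 2 * f x}.indicator f t + c / 2) x := by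
        refine setMax_mono (fun t => ?_) x
        by_cases ht : c < 2 * f t
        · rw [indicator_of_mem (by exact ht)]; exact le_self_add
        · rw [indicator_of_notMem (by exact ht), zero_add, ENNReal.le_div_iff_mul_le (by simp)
            (by simp), mul_comm]
          exact not_lt.1 ht
    _ ≤ setMax balls ({x | c < 2 * f x}.indicator f) x + setMax balls (fun _ => c / 2) x :=
        setMax_add_le (hf.indicator hm) x
    _ ≤ c / 2 + c / 2 := add_le_add h (setMax_le (fun _ => le_rfl) x)
    _ = c := ENNReal.add_halves c

/-- Weak type inequality, integrated in the level with the kernel of the layer cake formula. -/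
theorem powKernel_weak_type (f w : ℝ → ℝ≥0∞) (hf : Measurable f) (hw : Measurable w) (q : ℝ)
    {t : ℝ} (ht : 0 < t) : ∫⁻ x, powKernel q (setMax balls f x) t * w x
      ≤ ∫⁻ x, 10 * (powKernel (q - 1) (2 * f x) t * (f x * setMax balls w x)) := by
  set c := ENNReal.ofReal t with hc
  -- The factor `c / 2` is spent on the truncated weak type inequality at level `c = t`. What
  -- remains is the kernel of order `q - 1`.
  have hsplit : ENNReal.ofReal (t ^ (q - 1))
      = 2 * ENNReal.ofReal (t ^ (q - 1 - 1)) * (c / 2) := by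
    have : t ^ (q - 1) = t ^ (q - 1 - 1) * t := by
      rw [← Real.rpow_add_one ht.ne']; ring_nf
    rw [this, ENNReal.ofReal_mul (by positivity), mul_comm 2, mul_assoc,
      ENNReal.mul_div_cancel (by simp) (by simp)]
  have hmc : MeasurableSet {x | c < setMax balls f x} :=
    measurableSet_lt measurable_const (measurable_setMax measurableSet_balls f)
  calc ∫⁻ x, powKernel q (setMax balls f x) t * w x
      = ∫⁻ x, {x | c < setMax balls f x}.indicator
          (fun x => ENNReal.ofReal (t ^ (q - 1)) * w x) x := by
        refine lintegral_congr fun x => ?_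
        by_cases h : c < setMax balls f x
        · rw [powKernel_of_lt h, indicator_of_mem (by exact h)]
        · rw [powKernel_of_not_lt h, indicator_of_notMem (by exact h), zero_mul]
    _ = 2 * ENNReal.ofReal (t ^ (q - 1 - 1)) *
          (c / 2 * ∫⁻ x in {x | c < setMax balls f x}, w x) := by
        rw [lintegral_indicator hmc, lintegral_const_mul _ hw, hsplit, mul_assoc]
    _ ≤ 2 * ENNReal.ofReal (t ^ (q - 1 - 1)) *
          (5 * ∫⁻ x, {x | c < 2 * f x}.indicator f x * setMax balls w x) := by
        exact mul_le_mul_right (weak_type_truncated f w hf c) _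
    _ = 10 * (ENNReal.ofReal (t ^ (q - 1 - 1)) *
          ∫⁻ x, {x | c < 2 * f x}.indicator f x * setMax balls w x) := by
        rw [show (10 : ℝ≥0∞) = 2 * 5 by norm_num]; ring
    _ = _ := by
        rw [← lintegral_const_mul' _ _ ENNReal.ofReal_ne_top,
          ← lintegral_const_mul' _ _ (by norm_num)]
        refine lintegral_congr fun x => ?_
        by_cases h : c < 2 * f x
        · rw [indicator_of_mem (by exact h), powKernel_of_lt h]
        · rw [indicator_of_notMem (by exact h), powKernel_of_not_lt h]
          simp

/-- Weighted strong type inequality for the maximal function, for exponents `q > 1`. -/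
theorem strong_type {q : ℝ} (hq : 1 < q) : ∃ C : ℝ≥0, ∀ f w : ℝ → ℝ≥0∞, Measurable f →
    Measurable w → ∫⁻ x, setMax balls f x ^ q * w x ≤ C * ∫⁻ x, f x ^ q * setMax balls w x := by
  have hq0 : 0 < q := by linarith
  have hq1 : 0 < q - 1 := by linarith
  -- The factor q comes from the layer cake formula for the power q, 10 from the weak type bound,
  -- and 2^(q-1) / (q-1) from integrating the kernel of order q - 1 up to the height 2f.
  have hC : ENNReal.ofReal q * (10 * (2 ^ (q - 1) / ENNReal.ofReal (q - 1))) ≠ ∞ := by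
    refine ENNReal.mul_ne_top ENNReal.ofReal_ne_top (ENNReal.mul_ne_top (by norm_num) ?_)
    refine ENNReal.div_ne_top (ENNReal.rpow_ne_top_of_nonneg hq1.le (by norm_num)) ?_
    simpa using hq1
  refine ⟨(ENNReal.ofReal q * (10 * (2 ^ (q - 1) / ENNReal.ofReal (q - 1)))).toNNReal,
    fun f w hf hw => ?_⟩
  rw [ENNReal.coe_toNNReal hC]
  have hMf : Measurable (setMax balls f) := measurable_setMax measurableSet_balls f
  have hMw : Measurable (setMax balls w) := measurable_setMax measurableSet_balls w
  have hoq : ENNReal.ofReal q ≠ 0 := by simpa using hq0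
  have h2f : Measurable fun x => 2 * f x := hf.const_mul 2
  calc ∫⁻ x, setMax balls f x ^ q * w x
      = ∫⁻ x, ENNReal.ofReal q * ∫⁻ t in Ioi (0 : ℝ), powKernel q (setMax balls f x) t * w x := by
        refine lintegral_congr fun x => ?_
        rw [lintegral_mul_const _ (measurable_powKernel_right q _), lintegral_powKernel hq0, ← mul_assoc,
          ENNReal.mul_div_cancel hoq ENNReal.ofReal_ne_top]
    _ = ENNReal.ofReal q * ∫⁻ x, ∫⁻ t in Ioi (0 : ℝ), powKernel q (setMax balls f x) t * w x :=
        lintegral_const_mul' _ _ ENNReal.ofReal_ne_top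
    _ = ENNReal.ofReal q * ∫⁻ t in Ioi (0 : ℝ), ∫⁻ x, powKernel q (setMax balls f x) t * w x := by
        have h : Measurable fun z : ℝ × ℝ => powKernel q (setMax balls f z.1) z.2 * w z.1 :=
          (measurable_powKernel q hMf).mul (hw.comp measurable_fst)
        congr 1
        exact lintegral_lintegral_swap (f := fun x t => powKernel q (setMax balls f x) t * w x)
          h.aemeasurable
    _ ≤ ENNReal.ofReal q * ∫⁻ t in Ioi (0 : ℝ), ∫⁻ x, 10 *
          (powKernel (q - 1) (2 * f x) t * (f x * setMax balls w x)) := by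
        refine mul_le_mul_right (setLIntegral_mono' measurableSet_Ioi fun t ht => ?_) _
        exact powKernel_weak_type f w hf hw q ht
    _ = ENNReal.ofReal q * ∫⁻ x, ∫⁻ t in Ioi (0 : ℝ), 10 *
          (powKernel (q - 1) (2 * f x) t * (f x * setMax balls w x)) := by
        have h : Measurable fun z : ℝ × ℝ =>
            10 * (powKernel (q - 1) (2 * f z.1) z.2 * (f z.1 * setMax balls w z.1)) :=
          ((measurable_powKernel (q - 1) h2f).mul
            ((hf.mul hMw).comp measurable_fst)).const_mul 10
        congr 1
        exact (lintegral_lintegral_swap (f := fun x t =>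
          10 * (powKernel (q - 1) (2 * f x) t * (f x * setMax balls w x))) h.aemeasurable).symm
    _ = ENNReal.ofReal q * ∫⁻ x,
          10 * (2 ^ (q - 1) / ENNReal.ofReal (q - 1)) * (f x ^ q * setMax balls w x) := by
        congr 1
        refine lintegral_congr fun x => ?_
        rw [lintegral_const_mul' _ _ (by norm_num), lintegral_mul_const _ (measurable_powKernel_right _ _),
          lintegral_powKernel hq1, ENNReal.mul_rpow_of_nonneg _ _ hq1.le]
        have : f x ^ q = f x ^ (q - 1) * f x := by
          conv_rhs => rw [← ENNReal.rpow_one (f x), ← ENNReal.rpow_mul, one_mul]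
          rw [← ENNReal.rpow_add_of_nonneg _ _ hq1.le zero_le_one, sub_add_cancel]
        rw [this, div_eq_mul_inv, div_eq_mul_inv]
        ring
    _ = _ := by
        have h : Measurable fun x => f x ^ q * setMax balls w x := (hf.pow_const q).mul hMw
        rw [lintegral_const_mul _ h]
        ring

/-! ### Coordinate and iterated maximal functions on ℝ^d -/

variable {d : ℕ}

open Function (update)

/-- The maximal function in the coordinate `i`, over the sets of the family `S`. -/
noncomputable def coordMax {ι : Type*} (S : ι → Set ℝ) (i : Fin d) (f : (Fin d → ℝ) → ℝ≥0∞)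
    (x : Fin d → ℝ) : ℝ≥0∞ :=
  setMax S (fun t => f (update x i t)) (x i)

/-- The composition of the coordinate maximal functions along a list of coordinates. -/
noncomputable def iterMax {ι : Type*} (S : ι → Set ℝ) (l : List (Fin d))
    (f : (Fin d → ℝ) → ℝ≥0∞) : (Fin d → ℝ) → ℝ≥0∞ :=
  l.foldr (coordMax S) f

section iterMax

variable {ι : Type*} {S : ι → Set ℝ}

theorem measurable_lintegral_update (s : Set ℝ) (i : Fin d) {f : (Fin d → ℝ) → ℝ≥0∞}
    (hf : Measurable f) : Measurable fun x => ∫⁻ t in s, f (update x i t) :=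
  Measurable.lintegral_prod_right' (f := fun z : (Fin d → ℝ) × ℝ => f (update z.1 i z.2))
    (hf.comp measurable_update')

theorem measurable_coordMax [Countable ι] (hS : ∀ k, MeasurableSet (S k)) (i : Fin d)
    {f : (Fin d → ℝ) → ℝ≥0∞} (hf : Measurable f) : Measurable (coordMax S i f) := by
  have : coordMax S i f = fun x => ⨆ k, {x : Fin d → ℝ | x i ∈ S k}.indicator
      (fun x => (∫⁻ t in S k, f (update x i t)) / volume (S k)) x := by
    ext x; simp only [coordMax, setMax, indicator, mem_ofPred_eq]
  rw [this]
  refine Measurable.iSup fun k => Measurable.indicator ?_ ?_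
  · exact (measurable_lintegral_update _ i hf).div_const _
  · exact measurable_pi_apply i (hS k)

theorem measurable_iterMax [Countable ι] (hS : ∀ k, MeasurableSet (S k)) (l : List (Fin d))
    {f : (Fin d → ℝ) → ℝ≥0∞} (hf : Measurable f) : Measurable (iterMax S l f) := by
  induction l with
  | nil => exact hf
  | cons i l ih => exact measurable_coordMax hS i ih

theorem coordMax_le (i : Fin d) {f : (Fin d → ℝ) → ℝ≥0∞} {c : ℝ≥0∞} (h : ∀ x, f x ≤ c)
    (x : Fin d → ℝ) : coordMax S i f x ≤ c :=
  setMax_le (fun _ => h _) _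

theorem iterMax_le (l : List (Fin d)) {f : (Fin d → ℝ) → ℝ≥0∞} {c : ℝ≥0∞} (h : ∀ x, f x ≤ c)
    (x : Fin d → ℝ) : iterMax S l f x ≤ c := by
  induction l generalizing x with
  | nil => exact h x
  | cons i l ih => exact coordMax_le i ih x

/-- Averages over a product set are controlled by the iterated maximal function. -/
theorem lmarginal_le_iterMax [Countable ι] (hS : ∀ k, MeasurableSet (S k)) {l : List (Fin d)}
    (hl : l.Nodup) {R : Fin d → Set ℝ} {c : Fin d → ℝ≥0∞}
    (hR : ∀ i ∈ l, ∀ (f : ℝ → ℝ≥0∞), ∀ t ∈ R i, ∫⁻ s in R i, f s ≤ c i * setMax S f t)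
    {f : (Fin d → ℝ) → ℝ≥0∞} (hf : Measurable f) {x : Fin d → ℝ} (hx : ∀ i ∈ l, x i ∈ R i) :
    lmarginal (fun i => volume.restrict (R i)) l.toFinset f x ≤
      (l.map c).prod * iterMax S l f x := by
  induction l generalizing x with
  | nil => simp [iterMax]
  | cons i l ih =>
    obtain ⟨hil, hl⟩ := List.nodup_cons.1 hl
    have hm : Measurable (iterMax S l f) := measurable_iterMax hS l hf
    rw [List.toFinset_cons, lmarginal_insert _ hf (by simpa using hil)]
    calc ∫⁻ t in R i, lmarginal (fun i => volume.restrict (R i)) l.toFinset f (update x i t)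
        ≤ ∫⁻ t in R i, (l.map c).prod * iterMax S l f (update x i t) := by
          refine lintegral_mono fun t => ih hl (fun j hj => hR j (List.mem_cons_of_mem _ hj)) ?_
          intro j hj
          have hne : j ≠ i := by rintro rfl; exact hil hj
          rw [Function.update_of_ne hne]
          exact hx j (List.mem_cons_of_mem _ hj)
      _ = (l.map c).prod * ∫⁻ t in R i, iterMax S l f (update x i t) :=
          lintegral_const_mul _ (hm.comp (measurable_update x))
      _ ≤ (l.map c).prod * (c i * coordMax S i (iterMax S l f) x) := by
          gcongr
          exact hR i List.mem_cons_self _ _ (hx i List.mem_cons_self)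
      _ = _ := by
          rw [List.map_cons, List.prod_cons]
          simp only [iterMax, List.foldr_cons]
          ring

theorem setLIntegral_pi_le_iterMax [Countable ι] (hS : ∀ k, MeasurableSet (S k))
    {R : Fin d → Set ℝ} {c : Fin d → ℝ≥0∞}
    (hR : ∀ i, ∀ (f : ℝ → ℝ≥0∞), ∀ t ∈ R i, ∫⁻ s in R i, f s ≤ c i * setMax S f t)
    {f : (Fin d → ℝ) → ℝ≥0∞} (hf : Measurable f) {x : Fin d → ℝ} (hx : x ∈ Set.pi univ R) :
    ∫⁻ y in Set.pi univ R, f y ≤ (∏ i, c i) * iterMax S (List.finRange d) f x := by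
  have h := lmarginal_le_iterMax hS (List.nodup_finRange d) (fun i _ => hR i) hf
    (x := x) fun i _ => hx i (mem_univ i)
  rwa [List.toFinset_finRange, lmarginal_univ, ← Measure.restrict_pi_pi, ← volume_pi,
    ← List.ofFn_eq_map, List.prod_ofFn] at h

end iterMax

/-- Fubini reduces this to `strong_type` on each line parallel to the axis `i`. -/
theorem coordMax_strong_type {q : ℝ} (hq : 1 < q) : ∃ C : ℝ≥0, ∀ (i : Fin d)
    (f w : (Fin d → ℝ) → ℝ≥0∞), Measurable f → Measurable w →
    ∫⁻ x, coordMax balls i f x ^ q * w x ≤ C * ∫⁻ x, f x ^ q * coordMax balls i w x := by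
  obtain ⟨C, hC⟩ := strong_type hq
  refine ⟨C, fun i f w hf hw => ?_⟩
  have hMf := measurable_coordMax measurableSet_balls i hf
  have hMw := measurable_coordMax measurableSet_balls i hw
  rw [← lintegral_const_mul' _ _ ENNReal.coe_ne_top, volume_pi]
  refine lintegral_le_of_lmarginal_le {i} ((hMf.pow_const q).mul hw)
    (((hf.pow_const q).mul hMw).const_mul _) ?_
  rw [lmarginal_singleton, lmarginal_singleton]
  intro x
  have h := hC (fun t => f (update x i t)) (fun t => w (update x i t))
    (hf.comp (measurable_update x)) (hw.comp (measurable_update x))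
  rw [← lintegral_const_mul' _ _ ENNReal.coe_ne_top] at h
  simpa [coordMax] using h

/-- Weighted strong type inequality for iterated maximal functions. -/
theorem iterMax_strong_type {q : ℝ} (hq : 1 < q) (l : List (Fin d)) : ∃ C : ℝ≥0, ∀
    (f w : (Fin d → ℝ) → ℝ≥0∞), Measurable f → Measurable w →
    ∫⁻ x, iterMax balls l f x ^ q * w x ≤ C * ∫⁻ x, f x ^ q * iterMax balls l.reverse w x := by
  obtain ⟨C, hC⟩ := coordMax_strong_type (d := d) hq
  induction l with
  | nil => exact ⟨1, fun f w _ _ => by simp [iterMax]⟩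
  | cons i l ih =>
    obtain ⟨C', hC'⟩ := ih
    refine ⟨C * C', fun f w hf hw => ?_⟩
    -- The outermost operator is the first to be moved onto the weight and so ends up innermost
    -- there. This reverses the list.
    calc ∫⁻ x, iterMax balls (i :: l) f x ^ q * w x
        ≤ C * ∫⁻ x, iterMax balls l f x ^ q * coordMax balls i w x :=
          hC i _ w (measurable_iterMax measurableSet_balls l hf) hw
      _ ≤ C * (C' * ∫⁻ x, f x ^ q * iterMax balls l.reverse (coordMax balls i w) x) :=
          mul_le_mul_right (hC' f _ hf (measurable_coordMax measurableSet_balls i hw)) _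
      _ = _ := by
          simp only [iterMax, List.reverse_cons, List.foldr_append, List.foldr_cons,
            List.foldr_nil, ENNReal.coe_mul, mul_assoc]

/-- The weight 1 suffices, since its maximal functions are at most 1. -/
theorem iterMax_lintegral_rpow_le {q : ℝ} (hq : 1 < q) (l : List (Fin d)) : ∃ C : ℝ≥0, ∀
    f : (Fin d → ℝ) → ℝ≥0∞, Measurable f →
    ∫⁻ x, iterMax balls l f x ^ q ≤ C * ∫⁻ x, f x ^ q := by
  obtain ⟨C, hC⟩ := iterMax_strong_type hq l
  refine ⟨C, fun f hf => ?_⟩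
  have h := hC f 1 hf measurable_one
  simp only [Pi.one_apply, mul_one] at h
  refine h.trans (mul_le_mul_right (lintegral_mono fun x => ?_) _)
  exact mul_le_of_le_one_right' (iterMax_le _ (fun _ => le_rfl) x)

/-! ### Duality and the Fefferman–Stein vector valued inequality -/

/-- If `∫ g w` is controlled by `∫ h Aw` for all weights `w`, with `A` bounded on the dual space
of `L ^ p`, then `g` is controlled by `h` in `L ^ p`. -/
theorem lintegral_rpow_le_of_weighted {p : ℝ} (hp : 1 < p) {C D : ℝ≥0}
    {A : ((Fin d → ℝ) → ℝ≥0∞) → (Fin d → ℝ) → ℝ≥0∞} (hA : ∀ w, Measurable w → Measurable (A w))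
    (hD : ∀ w, Measurable w → ∫⁻ x, A w x ^ (p / (p - 1)) ≤ D * ∫⁻ x, w x ^ (p / (p - 1)))
    {g h : (Fin d → ℝ) → ℝ≥0∞} (hg : Measurable g) (hh : Measurable h)
    (hC : ∀ w, Measurable w → ∫⁻ x, g x * w x ≤ C * ∫⁻ x, h x * A w x) :
    ∫⁻ x, g x ^ p ≤ (C * (D : ℝ≥0∞) ^ ((p - 1) / p)) ^ p * ∫⁻ x, h x ^ p := by
  have hp0 : 0 < p := by linarith
  have hp1 : 0 < p - 1 := by linarith
  have hpq : p.HolderConjugate (p / (p - 1)) := Real.HolderConjugate.conjExponent hp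
  -- The truncation in height and in space makes `∫ u ^ p` finite, so that a power of it can be
  -- cancelled. Fatou's lemma removes it at the end.
  let u : ℕ → (Fin d → ℝ) → ℝ≥0∞ := fun N =>
    (Metric.closedBall 0 N).indicator fun x => min (g x) N
  have hu : ∀ N, Measurable (u N) := fun N =>
    (hg.min measurable_const).indicator Metric.isClosed_closedBall.measurableSet
  have hug : ∀ N x, u N x ≤ g x := fun N x =>
    (indicator_le_self _ _ x).trans (min_le_left _ _)
  have hbound : ∀ N, ∫⁻ x, u N x ^ p ≤
      (C * (D : ℝ≥0∞) ^ ((p - 1) / p)) ^ p * ∫⁻ x, h x ^ p := by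
    intro N
    set X := ∫⁻ x, u N x ^ p with hX
    have hXtop : X ≠ ∞ := by
      have : X ≤ ∫⁻ x, (Metric.closedBall (0 : Fin d → ℝ) N).indicator
          (fun _ => (N : ℝ≥0∞) ^ p) x := by
        refine lintegral_mono fun x => ?_
        by_cases hx : x ∈ Metric.closedBall (0 : Fin d → ℝ) N
        · simp only [u, indicator_of_mem hx]
          exact ENNReal.rpow_le_rpow (min_le_right _ _) hp0.le
        · simp [u, indicator_of_notMem hx, hp0]
      refine ne_top_of_le_ne_top ?_ this
      rw [lintegral_indicator_const Metric.isClosed_closedBall.measurableSet]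
      refine ENNReal.mul_ne_top (ENNReal.rpow_ne_top_of_nonneg hp0.le (by simp)) ?_
      exact measure_closedBall_lt_top.ne
    have hw : Measurable fun x => u N x ^ (p - 1) := (hu N).pow_const _
    have hwq : ∀ x, (u N x ^ (p - 1)) ^ (p / (p - 1)) = u N x ^ p := fun x => by
      rw [← ENNReal.rpow_mul, mul_div_cancel₀ _ hp1.ne']
    -- The test weight is u^(p-1), whose power of exponent p / (p - 1) is again u^p. Hölder's
    -- inequality separates `h` from the maximal function of the weight.
    have h1 : X ≤ C * ((∫⁻ x, h x ^ p) ^ (1 / p) * (D * X) ^ ((p - 1) / p)) := by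
      calc X ≤ ∫⁻ x, g x * u N x ^ (p - 1) := by
            refine lintegral_mono fun x => ?_
            calc u N x ^ p = u N x ^ (1 + (p - 1)) := by ring_nf
              _ = u N x * u N x ^ (p - 1) := by
                rw [ENNReal.rpow_add_of_nonneg _ _ zero_le_one hp1.le, ENNReal.rpow_one]
              _ ≤ g x * u N x ^ (p - 1) := mul_le_mul_left (hug N x) _
        _ ≤ C * ∫⁻ x, h x * A (fun x => u N x ^ (p - 1)) x := hC _ hw
        _ ≤ C * ((∫⁻ x, h x ^ p) ^ (1 / p) *
              (∫⁻ x, A (fun x => u N x ^ (p - 1)) x ^ (p / (p - 1))) ^ (1 / (p / (p - 1)))) :=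
            mul_le_mul_right (ENNReal.lintegral_mul_le_Lp_mul_Lq volume hpq hh.aemeasurable
              (hA _ hw).aemeasurable) _
        _ ≤ _ := by
            rw [one_div_div]
            gcongr
            refine (hD _ hw).trans_eq ?_
            simp only [hwq, hX]
    rcases eq_or_ne X 0 with h0 | h0
    · rw [h0]; exact zero_le
    have h2 : X ^ (1 / p) ≤ C * (D : ℝ≥0∞) ^ ((p - 1) / p) * (∫⁻ x, h x ^ p) ^ (1 / p) := by
      have hXe : X ^ ((p - 1) / p) ≠ 0 := by simp [ENNReal.rpow_eq_zero_iff, h0, hXtop]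
      have hXe' : X ^ ((p - 1) / p) ≠ ∞ := ENNReal.rpow_ne_top_of_nonneg (by positivity) hXtop
      refine (ENNReal.mul_le_mul_iff_left hXe hXe').1 ?_
      calc X ^ (1 / p) * X ^ ((p - 1) / p) = X := by
            rw [← ENNReal.rpow_add _ _ h0 hXtop, ← add_div, add_sub_cancel, div_self hp0.ne',
              ENNReal.rpow_one]
        _ ≤ _ := h1
        _ = _ := by rw [ENNReal.mul_rpow_of_nonneg _ _ (by positivity)]; ring
    calc X = (X ^ (1 / p)) ^ p := by
          rw [← ENNReal.rpow_mul, one_div_mul_cancel hp0.ne', ENNReal.rpow_one]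
      _ ≤ (C * (D : ℝ≥0∞) ^ ((p - 1) / p) * (∫⁻ x, h x ^ p) ^ (1 / p)) ^ p :=
          ENNReal.rpow_le_rpow h2 hp0.le
      _ = _ := by
          rw [ENNReal.mul_rpow_of_nonneg _ _ hp0.le, ← ENNReal.rpow_mul _ (1 / p),
            one_div_mul_cancel hp0.ne', ENNReal.rpow_one]
  have hlim : ∀ x, Filter.Tendsto (fun N => u N x ^ p) Filter.atTop (nhds (g x ^ p)) := by
    intro x
    refine (ENNReal.continuous_rpow_const.tendsto _).comp ?_
    have h1 : Filter.Tendsto (fun N : ℕ => min (g x) (N : ℝ≥0∞)) Filter.atTop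
        (nhds (min (g x) ∞)) := tendsto_const_nhds.min ENNReal.tendsto_nat_nhds_top
    rw [min_eq_left le_top] at h1
    refine h1.congr' ?_
    obtain ⟨n, hn⟩ := exists_nat_ge ‖x‖
    filter_upwards [Filter.eventually_ge_atTop n] with N hN
    have : x ∈ Metric.closedBall (0 : Fin d → ℝ) N := by
      rw [mem_closedBall_zero_iff]
      exact hn.trans (by exact_mod_cast hN)
    simp only [u, indicator_of_mem this]
  calc ∫⁻ x, g x ^ p = ∫⁻ x, Filter.liminf (fun N => u N x ^ p) Filter.atTop :=
        lintegral_congr fun x => (hlim x).liminf_eq.symm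
    _ ≤ Filter.liminf (fun N => ∫⁻ x, u N x ^ p) Filter.atTop :=
        lintegral_liminf_le fun N => (hu N).pow_const _
    _ ≤ _ := Filter.liminf_le_of_le ⟨0, by simp⟩ fun b hb => by
        obtain ⟨N, hN⟩ := hb.exists
        exact hN.trans (hbound N)

/-- The Fefferman–Stein vector valued inequality in `L ^ p (ℓ ^ 2)`, squared. -/
theorem vector_valued {p : ℝ} (hp : 1 ≤ p) (l : List (Fin d)) : ∃ C : ℝ≥0, ∀ {ι : Type}
    [Countable ι] (a : ι → ℝ≥0∞) (f : ι → (Fin d → ℝ) → ℝ≥0∞), (∀ k, Measurable (f k)) →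
    ∫⁻ x, (∑' k, a k * iterMax balls l (f k) x ^ 2) ^ p
      ≤ C * ∫⁻ x, (∑' k, a k * f k x ^ 2) ^ p := by
  obtain ⟨C, hC⟩ := iterMax_strong_type (q := 2) (by norm_num) l
  have hM := fun {f : (Fin d → ℝ) → ℝ≥0∞} (hf : Measurable f) =>
    measurable_iterMax measurableSet_balls l hf
  have hM' := fun {f : (Fin d → ℝ) → ℝ≥0∞} (hf : Measurable f) =>
    measurable_iterMax measurableSet_balls l.reverse hf
  -- With the exponent 2 the weighted inequality is additive in the terms, so it sums over `k`. The
  -- weight 1 gives p = 1, and duality gives p > 1.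
  have key : ∀ {ι : Type} [Countable ι] (a : ι → ℝ≥0∞) (f : ι → (Fin d → ℝ) → ℝ≥0∞),
      (∀ k, Measurable (f k)) → ∀ w, Measurable w →
      ∫⁻ x, (∑' k, a k * iterMax balls l (f k) x ^ 2) * w x
        ≤ C * ∫⁻ x, (∑' k, a k * f k x ^ 2) * iterMax balls l.reverse w x := by
    intro ι _ a f hf w hw
    have h2 : ∀ k, ∫⁻ x, a k * iterMax balls l (f k) x ^ 2 * w x
        ≤ C * ∫⁻ x, a k * f k x ^ 2 * iterMax balls l.reverse w x := by
      intro k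
      have h := hC (f k) w (hf k) hw
      simp only [ENNReal.rpow_ofNat] at h
      simp only [mul_assoc]
      have m1 : Measurable fun x => iterMax balls l (f k) x ^ 2 * w x :=
        ((hM (hf k)).pow_const 2).mul hw
      have m2 : Measurable fun x => f k x ^ 2 * iterMax balls l.reverse w x :=
        ((hf k).pow_const 2).mul (hM' hw)
      rw [lintegral_const_mul _ m1, lintegral_const_mul _ m2, mul_left_comm]
      exact mul_le_mul_right h _
    simp only [← ENNReal.tsum_mul_right]
    rw [lintegral_tsum, lintegral_tsum, ← ENNReal.tsum_mul_left]
    · exact ENNReal.tsum_le_tsum h2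
    · exact fun k => ((((hf k).pow_const 2).const_mul _).mul (hM' hw)).aemeasurable
    · exact fun k => ((((hM (hf k)).pow_const 2).const_mul _).mul hw).aemeasurable
  rcases hp.eq_or_lt with rfl | hp
  · refine ⟨C, fun a f hf => ?_⟩
    have h := key a f hf 1 measurable_one
    simp only [Pi.one_apply, mul_one] at h
    simp only [ENNReal.rpow_one]
    refine h.trans (mul_le_mul_right (lintegral_mono fun x => ?_) _)
    exact mul_le_of_le_one_right' (iterMax_le _ (fun _ => le_rfl) x)
  · have hp0 : 0 < p := by linarith
    obtain ⟨D, hD⟩ := iterMax_lintegral_rpow_le (q := p / (p - 1))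
      ((one_lt_div (by linarith)).2 (by linarith)) l.reverse
    refine ⟨((C * (D : ℝ≥0∞) ^ ((p - 1) / p)) ^ p).toNNReal, fun a f hf => ?_⟩
    rw [ENNReal.coe_toNNReal]
    · exact lintegral_rpow_le_of_weighted hp (A := iterMax balls l.reverse) (fun w hw => hM' hw)
        hD (Measurable.tsum fun k => ((hM (hf k)).pow_const 2).const_mul _)
        (Measurable.tsum fun k => ((hf k).pow_const 2).const_mul _) (key a f hf)
    · refine ENNReal.rpow_ne_top_of_nonneg hp0.le (ENNReal.mul_ne_top ENNReal.coe_ne_top ?_)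
      exact ENNReal.rpow_ne_top_of_nonneg (div_nonneg (by linarith) hp0.le) ENNReal.coe_ne_top

/-! ### Comparison with the strong maximal function -/

/-- Averages over an interval are controlled by the maximal function over rational intervals. -/
theorem setLIntegral_le_setMax_balls {S : Set ℝ} {a b : ℝ} (hab : a < b) (hS : S ⊆ Icc a b)
    (f : ℝ → ℝ≥0∞) {x : ℝ} (hx : x ∈ S) :
    ∫⁻ t in S, f t ≤ ENNReal.ofReal (2 * (b - a)) * setMax balls f x := by
  -- Moving each endpoint outwards to a rational by less than half the length gives an interval of
  -- length less than 2(b - a).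
  obtain ⟨a', ha1, ha2⟩ := exists_rat_btwn (show a - (b - a) / 2 < a by linarith)
  obtain ⟨b', hb1, hb2⟩ := exists_rat_btwn (show b < b + (b - a) / 2 by linarith)
  have hsub : S ⊆ balls ((a' + b') / 2, (b' - a') / 2) := by
    refine hS.trans ?_
    rw [balls, Real.closedBall_eq_Icc]
    refine Icc_subset_Icc ?_ ?_ <;> push_cast <;> linarith
  calc ∫⁻ t in S, f t ≤ ∫⁻ t in balls ((a' + b') / 2, (b' - a') / 2), f t :=
        lintegral_mono_set hsub
    _ ≤ volume (balls ((a' + b') / 2, (b' - a') / 2)) * setMax balls f x :=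
        lintegral_le_setMax (volume_balls_ne_top _) f (hsub hx)
    _ ≤ _ := by
        gcongr
        rw [volume_balls]
        refine ENNReal.ofReal_le_ofReal ?_
        push_cast; linarith

/-- The strong maximal function is controlled by the iterated one. -/
theorem strongMaximal_le_iterMax {f : (Fin d → ℝ) → ℝ} (hf : Measurable f) (x : Fin d → ℝ) :
    strongMaximal f x ≤ 2 ^ d * iterMax balls (List.finRange d) (fun y => ‖f y‖ₑ) x := by
  refine iSup₂_le fun a b => iSup₂_le fun hab hx => ?_
  refine ENNReal.div_le_of_le_mul ?_
  have h := setLIntegral_pi_le_iterMax measurableSet_balls (R := fun i => Ioo (a i) (b i))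
    (c := fun i => ENNReal.ofReal (2 * (b i - a i)))
    (fun i f t ht => setLIntegral_le_setMax_balls (hab i) Ioo_subset_Icc_self f ht) hf.enorm hx
  refine h.trans_eq ?_
  rw [box, Real.volume_pi_Ioo]
  simp only [ENNReal.ofReal_mul (zero_le_two : (0 : ℝ) ≤ 2), Finset.prod_mul_distrib]
  simp
  ring

/-! ### Dyadic intervals and their dilates -/

namespace DyadicInterval

instance : Countable DyadicInterval :=
  Function.Injective.countable (f := fun I : DyadicInterval => (I.scale, I.pos)) fun I J h => by
    simp only [Prod.mk.injEq] at h
    exact DyadicInterval.ext h.1 h.2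

theorem length_pos (I : DyadicInterval) : 0 < I.length := by
  unfold length; positivity

theorem length_le_iff {I J : DyadicInterval} : I.length ≤ J.length ↔ I.scale ≤ J.scale :=
  zpow_le_zpow_iff_right₀ (by norm_num)

theorem measurableSet_toSet (I : DyadicInterval) : MeasurableSet I.toSet := measurableSet_Ico

theorem measurableSet_dilate (t : ℝ) (I : DyadicInterval) : MeasurableSet (I.dilate t) :=
  measurableSet_Ico

theorem volume_dilate (t : ℝ) (I : DyadicInterval) :
    volume (I.dilate t) = ENNReal.ofReal (t * I.length) := by
  rw [dilate, Real.volume_Ico]; ring_nf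

theorem volume_toSet (I : DyadicInterval) : volume I.toSet = ENNReal.ofReal I.length := by
  rw [← dilate_one, volume_dilate, one_mul]

theorem volume_toSet_ne_top (I : DyadicInterval) : volume I.toSet ≠ ∞ := by
  simp [volume_toSet]

theorem volume_toSet_ne_zero (I : DyadicInterval) : volume I.toSet ≠ 0 := by
  simp [volume_toSet, I.length_pos]

theorem toSet_nonempty (I : DyadicInterval) : I.toSet.Nonempty := by
  rw [toSet, nonempty_Ico]
  have := I.length_pos
  unfold length at this
  nlinarith

theorem toSet_subset_of_inter {I J : DyadicInterval} (h : (I.toSet ∩ J.toSet).Nonempty)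
    (hs : I.scale ≤ J.scale) : I.toSet ⊆ J.toSet := by
  obtain ⟨n, hn⟩ := Int.le.dest hs
  have hpow : (2 : ℝ) ^ J.scale = 2 ^ n * 2 ^ I.scale := by
    rw [← hn, zpow_add₀ two_ne_zero, zpow_natCast, mul_comm]
  obtain ⟨x, ⟨h1, h2⟩, h3, h4⟩ := h
  have hk : (0 : ℝ) < 2 ^ I.scale := by positivity
  rw [hpow, ← mul_assoc] at h3 h4
  have h5 : (J.pos : ℝ) * 2 ^ n < I.pos + 1 := lt_of_mul_lt_mul_right (h3.trans_lt h2) hk.le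
  have h6 : (I.pos : ℝ) < (J.pos + 1) * 2 ^ n := lt_of_mul_lt_mul_right (h1.trans_lt h4) hk.le
  have h5' : J.pos * 2 ^ n ≤ I.pos := Int.lt_add_one_iff.1 (by exact_mod_cast h5)
  have h6' : I.pos + 1 ≤ (J.pos + 1) * 2 ^ n := Int.add_one_le_iff.2 (by exact_mod_cast h6)
  refine Ico_subset_Ico ?_ ?_
  · rw [hpow, ← mul_assoc]
    exact mul_le_mul_of_nonneg_right (by exact_mod_cast h5') hk.le
  · rw [hpow, ← mul_assoc]
    exact mul_le_mul_of_nonneg_right (by exact_mod_cast h6') hk.le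

theorem exists_mem (k : ℤ) (x : ℝ) : ∃ J : DyadicInterval, J.scale = k ∧ x ∈ J.toSet := by
  have hk : (0 : ℝ) < 2 ^ k := by positivity
  refine ⟨⟨k, ⌊x / 2 ^ k⌋⟩, rfl, ?_, ?_⟩
  · exact (le_div_iff₀ hk).1 (Int.floor_le _)
  · exact (div_lt_iff₀ hk).1 (Int.lt_floor_add_one _)

theorem eq_of_mem {I J : DyadicInterval} {x : ℝ} (hI : x ∈ I.toSet) (hJ : x ∈ J.toSet)
    (h : I.scale = J.scale) : I = J :=
  toSet_injective ((toSet_subset_of_inter ⟨x, hI, hJ⟩ h.le).antisymm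
    (toSet_subset_of_inter ⟨x, hJ, hI⟩ h.ge))

/-- The dilate by `t` sticks out of `J` by (t - 1)|J| / 2 at each end, so the hypothesis compares
the two overhangs. -/
theorem dilate_subset_dilate {I J : DyadicInterval} (h : I.toSet ⊆ J.toSet) {s t : ℝ}
    (hst : (s - 1) * I.length ≤ (t - 1) * J.length) : I.dilate s ⊆ J.dilate t := by
  rw [← dilate_one, ← dilate_one, dilate, dilate, Ico_subset_Ico_iff
    (by have := I.length_pos; linarith)] at h
  exact Ico_subset_Ico (by linarith [h.1]) (by linarith [h.2])

theorem toSet_subset_dilate (I : DyadicInterval) {t : ℝ} (ht : 1 ≤ t) :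
    I.toSet ⊆ I.dilate t := by
  rw [← dilate_one]
  refine dilate_subset_dilate subset_rfl ?_
  have := I.length_pos
  nlinarith

end DyadicInterval

open DyadicInterval

/-! ### Dyadic density sets and a Solyanik type estimate -/

/-- The union of the dilates of dyadic intervals, in each of which `E` has density at least `a`,
has measure at most `τ / a * |E|`. Version for bounded lengths. -/
theorem mul_volume_dilates_le_of_bounded {E : Set ℝ} (hE : MeasurableSet E) {a : ℝ≥0∞} {τ : ℝ}
    (hτ : 1 ≤ τ) {T : Set DyadicInterval} (hT : ∀ J ∈ T, a * volume J.toSet ≤ volume (E ∩ J.toSet))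
    {M : ℝ} (hM : ∀ J ∈ T, J.length ≤ M) :
    a * volume (⋃ J ∈ T, J.dilate τ) ≤ ENNReal.ofReal τ * volume E := by
  -- The covering constant 3/2 is below 2, so for dyadic intervals |I| ≤ 3/2 |J| already forces |I|
  -- ≤ |J|, and I ⊆ J as they meet. The selected intervals thus cover without enlargement, and so do
  -- their dilates.
  obtain ⟨u, huT, hdisj, hcov⟩ := Vitali.exists_disjoint_subfamily_covering_enlargement
    toSet T length (3 / 2) (by norm_num) (fun J _ => J.length_pos.le) M hM
    fun J _ => J.toSet_nonempty
  have hsub : (⋃ J ∈ T, J.dilate τ) ⊆ ⋃ J ∈ u, J.dilate τ := by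
    refine iUnion₂_subset fun I hI => ?_
    obtain ⟨J, hJ, hne, hle⟩ := hcov I hI
    refine subset_iUnion₂_of_subset J hJ ?_
    have hs : I.scale ≤ J.scale := by
      by_contra! h
      have h1 : J.scale + 1 ≤ I.scale := h
      have h2 : (2 : ℝ) ^ (J.scale + 1) ≤ 2 ^ I.scale :=
        zpow_le_zpow_right₀ (by norm_num) h1
      rw [zpow_add_one₀ two_ne_zero] at h2
      have h3 := J.length_pos
      unfold length at hle h3
      linarith
    refine dilate_subset_dilate (toSet_subset_of_inter hne hs) ?_
    exact mul_le_mul_of_nonneg_left (length_le_iff.2 hs) (by linarith)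
  have hone : ∀ J ∈ u, a * volume (J.dilate τ) ≤ ENNReal.ofReal τ * volume (E ∩ J.toSet) := by
    intro J hJ
    rw [volume_dilate, ENNReal.ofReal_mul (by linarith), ← volume_toSet, mul_left_comm]
    exact mul_le_mul_right (hT J (huT hJ)) _
  calc a * volume (⋃ J ∈ T, J.dilate τ) ≤ a * ∑' J : u, volume (J.1.dilate τ) := by
        gcongr
        refine (measure_mono hsub).trans ?_
        rw [biUnion_eq_iUnion]
        exact measure_iUnion_le _
    _ = ∑' J : u, a * volume (J.1.dilate τ) := ENNReal.tsum_mul_left.symm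
    _ ≤ ∑' J : u, ENNReal.ofReal τ * volume (E ∩ J.1.toSet) :=
        ENNReal.tsum_le_tsum fun J => hone J J.2
    _ = ENNReal.ofReal τ * volume (⋃ J : u, E ∩ J.1.toSet) := by
        rw [ENNReal.tsum_mul_left, measure_iUnion _ fun J => hE.inter J.1.measurableSet_toSet]
        intro I J hIJ
        exact ((pairwise_subtype_iff_pairwise_set u _).2 hdisj hIJ).mono inter_subset_right
          inter_subset_right
    _ ≤ _ := by
        gcongr
        exact iUnion_subset fun J => inter_subset_left

theorem mul_volume_dilates_le {E : Set ℝ} (hE : MeasurableSet E) {a : ℝ≥0∞} {τ : ℝ}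
    (hτ : 1 ≤ τ) {T : Set DyadicInterval}
    (hT : ∀ J ∈ T, a * volume J.toSet ≤ volume (E ∩ J.toSet)) :
    a * volume (⋃ J ∈ T, J.dilate τ) ≤ ENNReal.ofReal τ * volume E := by
  have hU : (⋃ J ∈ T, J.dilate τ) =
      ⋃ n : ℕ, ⋃ J ∈ {J | J ∈ T ∧ J.length ≤ n}, J.dilate τ := by
    ext x
    simp only [mem_iUnion, mem_ofPred_eq, exists_prop]
    constructor
    · rintro ⟨J, hJ, hx⟩
      obtain ⟨n, hn⟩ := exists_nat_ge J.length
      exact ⟨n, J, ⟨hJ, hn⟩, hx⟩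
    · rintro ⟨n, J, hJ, hx⟩
      exact ⟨J, hJ.1, hx⟩
  have hmono : Monotone fun n : ℕ => ⋃ J ∈ {J | J ∈ T ∧ J.length ≤ n}, J.dilate τ := by
    intro n m hnm
    refine biUnion_subset_biUnion_left fun J hJ => ⟨hJ.1, hJ.2.trans ?_⟩
    exact_mod_cast hnm
  rw [hU, hmono.measure_iUnion, ENNReal.mul_iSup]
  exact iSup_le fun n => mul_volume_dilates_le_of_bounded hE hτ (fun J hJ => hT J hJ.1)
    fun J hJ => hJ.2

/-- The union, over the lines parallel to the axis `i`, of the `τ`-dilates of the dyadic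
intervals of the line in which `W` has density at least `a`. -/
def densitySet (i : Fin d) (τ : ℝ) (a : ℝ≥0∞) (W : Set (Fin d → ℝ)) : Set (Fin d → ℝ) :=
  {x | ∃ J : DyadicInterval, x i ∈ J.dilate τ ∧
    a * volume J.toSet ≤ volume ({t | update x i t ∈ W} ∩ J.toSet)}

theorem measurableSet_densitySet (i : Fin d) (τ : ℝ) (a : ℝ≥0∞) {W : Set (Fin d → ℝ)}
    (hW : MeasurableSet W) : MeasurableSet (densitySet i τ a W) := by
  have : densitySet i τ a W = ⋃ J : DyadicInterval, {x | x i ∈ J.dilate τ} ∩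
      {x | a * volume J.toSet ≤ ∫⁻ t in J.toSet, W.indicator 1 (update x i t)} := by
    ext x
    simp only [densitySet, mem_ofPred_eq, mem_iUnion, mem_inter_iff]
    refine exists_congr fun J => and_congr_right fun _ => ?_
    have hm : MeasurableSet {t | update x i t ∈ W} := measurable_update x hW
    rw [← Measure.restrict_apply hm, ← lintegral_indicator_one hm]
    rfl
  rw [this]
  refine MeasurableSet.iUnion fun J => (measurable_pi_apply i (J.measurableSet_dilate τ)).inter ?_
  exact measurableSet_le measurable_const
    (measurable_lintegral_update _ i (measurable_one.indicator hW))

/-- On each line parallel to the axis `i` the density set is a union of dilates of the kind measured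
by `mul_volume_dilates_le`. Fubini then gives the claim. -/
theorem mul_volume_densitySet_le (i : Fin d) {τ : ℝ} (hτ : 1 ≤ τ) {a : ℝ≥0∞} (ha : a ≠ ∞)
    {W : Set (Fin d → ℝ)} (hW : MeasurableSet W) :
    a * volume (densitySet i τ a W) ≤ ENNReal.ofReal τ * volume W := by
  have hV := measurableSet_densitySet i τ a hW
  rw [← lintegral_indicator_one hV, ← lintegral_indicator_one hW,
    ← lintegral_const_mul' _ _ ha, ← lintegral_const_mul' _ _ ENNReal.ofReal_ne_top, volume_pi]
  refine lintegral_le_of_lmarginal_le {i} ((measurable_one.indicator hV).const_mul _)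
    ((measurable_one.indicator hW).const_mul _) fun x => ?_
  rw [lmarginal_singleton, lmarginal_singleton]
  have hmW : MeasurableSet {t | update x i t ∈ W} := measurable_update x hW
  have hmV : MeasurableSet {t | update x i t ∈ densitySet i τ a W} := measurable_update x hV
  have key := mul_volume_dilates_le (a := a) hmW hτ (T := {J |
    a * volume J.toSet ≤ volume ({t | update x i t ∈ W} ∩ J.toSet)}) fun J hJ => hJ
  have hset : (⋃ J ∈ {J : DyadicInterval | a * volume J.toSet ≤
      volume ({t | update x i t ∈ W} ∩ J.toSet)}, J.dilate τ) =
      {t | update x i t ∈ densitySet i τ a W} := by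
    ext t
    simp [densitySet, and_comm]
  rw [hset, ← lintegral_indicator_one hmW, ← lintegral_indicator_one hmV,
    ← lintegral_const_mul' _ _ ha, ← lintegral_const_mul' _ _ ENNReal.ofReal_ne_top] at key
  exact key

/-- If {h > 1 - θ} had density below 1 - θ in J, then h ≤ 1 would have mean at most (1 - θ) + θ(1 -
θ) = 1 - θ^2 there. -/
theorem setOf_lt_coordMax_subset (i : Fin d) {θ : ℝ} (h0 : 0 < θ) (h1 : θ < 1)
    {h : (Fin d → ℝ) → ℝ≥0∞} (hm : Measurable h) (hle : ∀ x, h x ≤ 1) :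
    {x | ENNReal.ofReal (1 - θ ^ 2) < coordMax toSet i h x} ⊆
      densitySet i 1 (ENNReal.ofReal (1 - θ)) {x | ENNReal.ofReal (1 - θ) < h x} := by
  intro x hx
  obtain ⟨J, hxJ, hJ⟩ := lt_setMax_iff.1 hx
  refine ⟨J, by rwa [dilate_one], ?_⟩
  have hmW : MeasurableSet {t | update x i t ∈ {x | ENNReal.ofReal (1 - θ) < h x}} :=
    measurable_update x (measurableSet_lt measurable_const hm)
  set G := {t | update x i t ∈ {x | ENNReal.ofReal (1 - θ) < h x}} with hG
  have hpt : ∀ t, h (update x i t) ≤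
      ENNReal.ofReal θ * G.indicator 1 t + ENNReal.ofReal (1 - θ) := by
    intro t
    by_cases ht : t ∈ G
    · rw [indicator_of_mem ht, Pi.one_apply, mul_one, ← ENNReal.ofReal_add h0.le (by linarith)]
      simpa using hle _
    · rw [indicator_of_notMem ht, mul_zero, zero_add]
      exact not_lt.1 ht
  have hint : ∫⁻ t in J.toSet, h (update x i t) ≤
      ENNReal.ofReal θ * volume (G ∩ J.toSet) + ENNReal.ofReal (1 - θ) * volume J.toSet := by
    calc ∫⁻ t in J.toSet, h (update x i t)
        ≤ ∫⁻ t in J.toSet, (ENNReal.ofReal θ * G.indicator 1 t + ENNReal.ofReal (1 - θ)) :=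
          lintegral_mono hpt
      _ = _ := by
          rw [lintegral_add_right _ measurable_const,
            lintegral_const_mul' _ _ ENNReal.ofReal_ne_top, lintegral_indicator_one hmW,
            Measure.restrict_apply hmW, lintegral_const, Measure.restrict_apply_univ]
  have hlt : ENNReal.ofReal (1 - θ ^ 2) * volume J.toSet < ∫⁻ t in J.toSet, h (update x i t) :=
    (ENNReal.lt_div_iff_mul_lt (Or.inl J.volume_toSet_ne_zero)
      (Or.inl J.volume_toSet_ne_top)).1 hJ
  have hsplit : ENNReal.ofReal (1 - θ ^ 2) =
      ENNReal.ofReal θ * ENNReal.ofReal (1 - θ) + ENNReal.ofReal (1 - θ) := by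
    rw [← ENNReal.ofReal_mul h0.le, ← ENNReal.ofReal_add (by nlinarith) (by linarith)]
    congr 1; ring
  have h2 := hlt.trans_le hint
  rw [hsplit, add_mul, mul_assoc] at h2
  have h3 := lt_of_add_lt_add_right h2
  exact (lt_of_mul_lt_mul_left' h3).le

/-- Solyanik type estimate for the iterated dyadic maximal function of an indicator. -/
theorem exists_volume_iterMax_le (l : List (Fin d)) {δ : ℝ} (hδ : 0 < δ) :
    ∃ η : ℝ, 0 < η ∧ η < 1 ∧ ∀ E : Set (Fin d → ℝ), MeasurableSet E →
      volume {x | ENNReal.ofReal (1 - η) < iterMax toSet l (E.indicator 1) x}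
        ≤ ENNReal.ofReal (1 + δ) * volume E := by
  induction l generalizing δ with
  | nil =>
    refine ⟨1 / 2, by norm_num, by norm_num, fun E hE => ?_⟩
    refine le_mul_of_one_le_of_le (by simp [hδ.le]) (measure_mono fun x hx => ?_)
    by_contra h
    simp [iterMax, indicator_of_notMem h] at hx
  | cons i l ih =>
    obtain ⟨δ', hδ', hle⟩ : ∃ δ' : ℝ, 0 < δ' ∧ (1 + δ') * (1 + δ') ≤ 1 + δ := by
      refine ⟨min δ 1 / 3, by positivity, ?_⟩
      have h1 := min_le_left δ 1
      have h2 := min_le_right δ 1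
      have h3 : 0 < min δ 1 := by positivity
      nlinarith
    obtain ⟨η, h0, h1, hη⟩ := ih hδ'
    -- The bound θ ≤ η puts `W` inside the level set of the induction hypothesis. The bound θ ≤ δ' /
    -- (1 + δ') makes the weak type constant 1 / (1 - θ) at most 1 + δ'.
    set θ := min η (δ' / (1 + δ')) with hθ
    have hθ0 : 0 < θ := by positivity
    have hθ1 : θ < 1 := (min_le_left _ _).trans_lt h1
    have hθδ : 1 ≤ (1 + δ') * (1 - θ) := by
      have : θ ≤ δ' / (1 + δ') := min_le_right _ _
      rw [le_div_iff₀ (by linarith)] at this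
      linarith
    refine ⟨θ ^ 2, by positivity, by nlinarith, fun E hE => ?_⟩
    have hm := measurable_iterMax measurableSet_toSet l
      (f := E.indicator 1) (measurable_one.indicator hE)
    have hle1 : ∀ x, iterMax toSet l (E.indicator 1) x ≤ 1 :=
      iterMax_le l fun x => indicator_le_self' (fun _ _ => zero_le) x
    set W := {x | ENNReal.ofReal (1 - θ) < iterMax toSet l (E.indicator 1) x}
    have hW : MeasurableSet W := measurableSet_lt measurable_const hm
    have hWle : volume W ≤ ENNReal.ofReal (1 + δ') * volume E := by
      refine le_trans (measure_mono fun x hx => ?_) (hη E hE)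
      exact lt_of_le_of_lt
        (ENNReal.ofReal_le_ofReal (by linarith [min_le_left η (δ' / (1 + δ'))])) hx
    have hD := mul_volume_densitySet_le i le_rfl (a := ENNReal.ofReal (1 - θ))
      ENNReal.ofReal_ne_top hW
    rw [ENNReal.ofReal_one, one_mul] at hD
    calc volume {x | ENNReal.ofReal (1 - θ ^ 2) < iterMax toSet (i :: l) (E.indicator 1) x}
        ≤ volume (densitySet i 1 (ENNReal.ofReal (1 - θ)) W) :=
          measure_mono (setOf_lt_coordMax_subset i hθ0 hθ1 hm hle1)
      _ ≤ ENNReal.ofReal ((1 + δ') * (1 - θ)) *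
            volume (densitySet i 1 (ENNReal.ofReal (1 - θ)) W) :=
          le_mul_of_one_le_left' (by simpa using hθδ)
      _ ≤ ENNReal.ofReal (1 + δ') * volume W := by
          rw [ENNReal.ofReal_mul (by linarith), mul_assoc]
          gcongr
      _ ≤ ENNReal.ofReal (1 + δ') * (ENNReal.ofReal (1 + δ') * volume E) := by gcongr
      _ = ENNReal.ofReal ((1 + δ') * (1 + δ')) * volume E := by
          rw [ENNReal.ofReal_mul (by linarith), mul_assoc]
      _ ≤ _ := by gcongr

/-! ### Dyadic rectangles, shadows and maximal functions of indicators -/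

theorem DyadicRect.measurableSet_toSet (R : DyadicRect d) : MeasurableSet R.toSet :=
  MeasurableSet.univ_pi fun i => (R i).measurableSet_toSet

theorem measurableSet_shadow (U : Set (DyadicRect d)) : MeasurableSet (shadow U) :=
  MeasurableSet.biUnion (to_countable U) fun R _ => R.measurableSet_toSet

theorem DyadicRect.volume_toSet (R : DyadicRect d) :
    volume R.toSet = ∏ i, volume (R i).toSet := by
  rw [DyadicRect.toSet, volume_pi_pi]

theorem DyadicRect.volume_toSet_ne_top (R : DyadicRect d) : volume R.toSet ≠ ∞ := by
  rw [R.volume_toSet]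
  exact ENNReal.prod_ne_top fun i _ => (R i).volume_toSet_ne_top

theorem DyadicRect.volume_toSet_ne_zero (R : DyadicRect d) : volume R.toSet ≠ 0 := by
  rw [R.volume_toSet]
  exact Finset.prod_ne_zero_iff.2 fun i _ => (R i).volume_toSet_ne_zero

theorem shadow_mono {U U' : Set (DyadicRect d)} (h : U' ⊆ U) : shadow U' ⊆ shadow U :=
  biUnion_subset_biUnion_left h

theorem mem_shadow {U : Set (DyadicRect d)} {x : Fin d → ℝ} :
    x ∈ shadow U ↔ ∃ R ∈ U, x ∈ R.toSet := by
  simp [shadow]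

theorem one_le_iterMax (l : List (Fin d)) {R : DyadicRect d} {f : (Fin d → ℝ) → ℝ≥0∞}
    (hf : ∀ x ∈ R.toSet, 1 ≤ f x) {x : Fin d → ℝ} (hx : x ∈ R.toSet) :
    1 ≤ iterMax toSet l f x := by
  induction l generalizing x with
  | nil => exact hf x hx
  | cons i l ih =>
    have h := lintegral_le_setMax (S := toSet) (k := R i) (R i).volume_toSet_ne_top
      (fun t => iterMax toSet l f (update x i t)) (hx i (mem_univ i))
    have h1 : volume (R i).toSet ≤ ∫⁻ t in (R i).toSet, iterMax toSet l f (update x i t) := by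
      calc volume (R i).toSet = ∫⁻ _ in (R i).toSet, 1 := by simp
        _ ≤ _ := by
          refine setLIntegral_mono' (R i).measurableSet_toSet fun t ht => ih fun j _ => ?_
          rcases eq_or_ne j i with rfl | hj
          · simpa using ht
          · simpa [hj] using hx j (mem_univ j)
    have h2 := h1.trans h
    nth_rewrite 1 [← mul_one (volume (R i).toSet)] at h2
    exact (ENNReal.mul_le_mul_iff_right (R i).volume_toSet_ne_zero
      (R i).volume_toSet_ne_top).1 h2

theorem strongMaximal_indicator_le_one (E : Set (Fin d → ℝ)) (x : Fin d → ℝ) :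
    strongMaximal (E.indicator fun _ => (1 : ℝ)) x ≤ 1 := by
  refine iSup₂_le fun a b => iSup₂_le fun _ _ => ENNReal.div_le_of_le_mul ?_
  calc ∫⁻ y in box a b, ‖E.indicator (fun _ => (1 : ℝ)) y‖ₑ ≤ ∫⁻ _ in box a b, 1 := by
        refine lintegral_mono fun y => ?_
        by_cases hy : y ∈ E <;> simp [hy]
    _ = 1 * volume (box a b) := by simp

/-- The maximal function of an indicator is at most 1, so every n ≥ 2 reduces to the exponent 2 of
`vector_valued`. -/
theorem strongMaximal_indicator_pow_le {E : Set (Fin d → ℝ)} (hE : MeasurableSet E) {n : ℕ}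
    (hn : 1 < n) (x : Fin d → ℝ) : strongMaximal (E.indicator fun _ => (1 : ℝ)) x ^ n ≤
      4 ^ d * iterMax balls (List.finRange d) (E.indicator 1) x ^ 2 := by
  have h := strongMaximal_le_iterMax (f := E.indicator fun _ => (1 : ℝ))
    (measurable_const.indicator hE) x
  have he : (fun y => ‖E.indicator (fun _ => (1 : ℝ)) y‖ₑ) = E.indicator 1 := by
    ext y
    by_cases hy : y ∈ E <;> simp [hy]
  rw [he] at h
  calc strongMaximal (E.indicator fun _ => (1 : ℝ)) x ^ n
      ≤ strongMaximal (E.indicator fun _ => (1 : ℝ)) x ^ 2 :=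
        pow_le_pow_right_of_le_one' (strongMaximal_indicator_le_one E x) hn
    _ ≤ (2 ^ d * iterMax balls (List.finRange d) (E.indicator 1) x) ^ 2 := by gcongr
    _ = _ := by
        rw [mul_pow, ← pow_mul, mul_comm d 2, pow_mul]; norm_num

/-! ### The enlargement of a shadow -/

variable [NeZero d]

/-- The coordinates other than the first one. -/
noncomputable def tailCoords (d : ℕ) [NeZero d] : List (Fin d) :=
  (Finset.univ.erase (0 : Fin d)).toList

/-- The set where the iterated dyadic maximal function, in all coordinates but the first one,
of the indicator of `E` exceeds `1 - η`. -/
noncomputable def levelSet (η : ℝ) (E : Set (Fin d → ℝ)) : Set (Fin d → ℝ) :=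
  {x | ENNReal.ofReal (1 - η) < iterMax toSet (tailCoords d) (E.indicator 1) x}

theorem measurableSet_levelSet (η : ℝ) {E : Set (Fin d → ℝ)} (hE : MeasurableSet E) :
    MeasurableSet (levelSet η E) :=
  measurableSet_lt measurable_const
    (measurable_iterMax measurableSet_toSet _ (measurable_one.indicator hE))

/-- The enlargement of `E`. -/
noncomputable def enlarge (η τ : ℝ) (E : Set (Fin d → ℝ)) : Set (Fin d → ℝ) :=
  densitySet 0 τ 1 (levelSet η E)

/-- The iterated dyadic maximal function of 1_E is at least 1 on each rectangle R of the collection,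
so on lines through R the side `R 0` lies in the level set and is admissible in `densitySet`. -/
theorem shadow_subset_enlarge {η τ : ℝ} (hη : 0 < η) (hτ : 1 ≤ τ) (U : Set (DyadicRect d)) :
    shadow U ⊆ enlarge η τ (shadow U) := by
  intro x hx
  obtain ⟨R, hR, hxR⟩ := mem_shadow.1 hx
  refine ⟨R 0, (R 0).toSet_subset_dilate hτ (hxR 0 (mem_univ _)), ?_⟩
  rw [one_mul, inter_eq_right.2]
  intro t ht
  change ENNReal.ofReal (1 - η) < iterMax toSet (tailCoords d) _ (update x 0 t)
  refine lt_of_lt_of_le (b := 1) (by simpa using hη) ?_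
  refine one_le_iterMax _ (R := R) (fun y hy => ?_) ?_
  · rw [indicator_of_mem (mem_shadow.2 ⟨R, hR, hy⟩)]; rfl
  · intro j _
    rcases eq_or_ne j 0 with rfl | hj
    · simpa using ht
    · simpa [hj] using hxR j (mem_univ j)

/-- If the dilate of `K × R'` is not contained in the enlargement of `E`, a subset `A` of `E` that
is a cylinder over `K` occupies at most the fraction `1 - η` of `R`. -/
theorem volume_inter_le_of_notMem_enlarge {η τ : ℝ} {E A : Set (Fin d → ℝ)}
    (hE : MeasurableSet E) (hA : MeasurableSet A) (hAE : A ⊆ E) {R : DyadicRect d}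
    {K : DyadicInterval} (hRK : (R 0).toSet ⊆ K.toSet)
    (hcyl : ∀ z ∈ A, z 0 ∈ K.toSet → ∀ t ∈ K.toSet, update z 0 t ∈ A) {x : Fin d → ℝ}
    (hx0 : x 0 ∈ K.dilate τ) (hx : ∀ i, i ≠ 0 → x i ∈ (R i).toSet)
    (hxV : x ∉ enlarge η τ E) :
    volume (R.toSet ∩ A) ≤ ENNReal.ofReal (1 - η) * volume R.toSet := by
  -- Otherwise `K`, on the line through `x`, lies entirely in the level set, and its dilate puts `x`
  -- in the enlargement.
  obtain ⟨t₀, ht₀, hy⟩ : ∃ t₀ ∈ K.toSet, update x 0 t₀ ∉ levelSet η E := by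
    by_contra! h
    refine hxV ⟨K, hx0, ?_⟩
    have hsub : K.toSet ⊆ {t | update x 0 t ∈ levelSet η E} := h
    rw [one_mul, inter_eq_right.2 hsub]
  set y := update x 0 t₀ with hyd
  have hy : iterMax toSet (tailCoords d) (E.indicator 1) y ≤ ENNReal.ofReal (1 - η) := not_lt.1 hy
  set s : Finset (Fin d) := Finset.univ.erase 0 with hs
  let μ : Fin d → Measure ℝ := fun i => volume.restrict (R i).toSet
  have h0s : (0 : Fin d) ∉ s := by simp [hs]
  have hmA : Measurable (A.indicator (1 : (Fin d → ℝ) → ℝ≥0∞)) := measurable_one.indicator hA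
  have hmE : Measurable (E.indicator (1 : (Fin d → ℝ) → ℝ≥0∞)) := measurable_one.indicator hE
  -- The slice through `y` of the remaining sides of `R` contains `y`, so the density of `E` in it
  -- is at most 1 - η.
  have hmarg : lmarginal μ s (E.indicator 1) y ≤
      (∏ i ∈ s, volume (R i).toSet) * ENNReal.ofReal (1 - η) := by
    have h := lmarginal_le_iterMax (S := toSet) measurableSet_toSet (l := tailCoords d)
      (Finset.nodup_toList _) (R := fun i => (R i).toSet) (c := fun i => volume (R i).toSet)
      (fun i _ f t ht => lintegral_le_setMax (k := R i) (R i).volume_toSet_ne_top f ht) hmE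
      (x := y) (fun i hi => by
        have hi0 : i ≠ 0 := by simpa [tailCoords] using hi
        simpa [hyd, hi0] using hx i hi0)
    rw [tailCoords, Finset.toList_toFinset, Finset.prod_map_toList] at h
    exact h.trans (mul_le_mul_right hy _)
  have hvol : volume (R.toSet ∩ A) = lmarginal μ Finset.univ (A.indicator 1) y := by
    rw [lmarginal_univ, ← Measure.restrict_pi_pi, ← volume_pi, lintegral_indicator_one hA,
      Measure.restrict_apply hA, inter_comm]
    rfl
  rw [hvol, ← Finset.insert_erase (Finset.mem_univ (0 : Fin d)), lmarginal_insert _ hmA h0s]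
  calc ∫⁻ t in (R 0).toSet, lmarginal μ s (A.indicator 1) (update y 0 t)
      ≤ ∫⁻ _ in (R 0).toSet, lmarginal μ s (E.indicator 1) y := by
        refine setLIntegral_mono' (R 0).measurableSet_toSet fun t ht => lintegral_mono fun z => ?_
        by_cases hz : Function.updateFinset (update y 0 t) s z ∈ A
        · have hz0 : Function.updateFinset (update y 0 t) s z 0 = t := by
            simp [Function.updateFinset, h0s]
          -- The cylinder property moves a point of `A` at height `t` to height `t₀`, where it lies
          -- in the sparse slice of `E`.
          have hmem := hcyl _ hz (by rw [hz0]; exact hRK ht) t₀ ht₀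
          have heq : update (Function.updateFinset (update y 0 t) s z) 0 t₀ =
              Function.updateFinset y s z := by
            ext i
            rcases eq_or_ne i 0 with rfl | hi
            · simp [Function.updateFinset, h0s, hyd]
            · have his : i ∈ s := by simp [hs, hi]
              simp [Function.updateFinset, his, hi]
          rw [heq] at hmem
          rw [indicator_of_mem hz, indicator_of_mem (hAE hmem)]
          simp
        · rw [indicator_of_notMem hz]; exact zero_le
    _ = lmarginal μ s (E.indicator 1) y * volume (R 0).toSet := by
        rw [lintegral_const, Measure.restrict_apply_univ]
    _ ≤ ((∏ i ∈ s, volume (R i).toSet) * ENNReal.ofReal (1 - η)) * volume (R 0).toSet := by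
        gcongr
    _ = _ := by
        rw [R.volume_toSet, ← Finset.prod_erase_mul _ _ (Finset.mem_univ (0 : Fin d))]
        ring

/-! ### Core parts and their bounded overlap -/

section corePart

variable (V : Set (Fin d → ℝ)) (U' : Set (DyadicRect d)) (j N : ℕ) (I : DyadicInterval)

theorem measurableSet_F : MeasurableSet (F V I j U') := measurableSet_shadow _

theorem F_subset_shadow : F V I j U' ⊆ shadow U' := shadow_mono fun _ h => h.1

/-- The part of `ℝ ^ d` covered by the sets `F(J, j, U')` with `J` at least `N` generations
above `I`. -/
def upperPart : Set (Fin d → ℝ) :=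
  ⋃ J ∈ {J : DyadicInterval | I.toSet ⊆ J.toSet ∧ I.scale + N ≤ J.scale}, F V J j U'

/-- The part of `F(I, j, U')` outside all `F(J, j, U')` with `J` at least `N` generations
above `I`. -/
def corePart : Set (Fin d → ℝ) := F V I j U' \ upperPart V U' j N I

theorem measurableSet_upperPart : MeasurableSet (upperPart V U' j N I) :=
  MeasurableSet.biUnion (to_countable _) fun J _ => measurableSet_F V U' j J

theorem measurableSet_corePart : MeasurableSet (corePart V U' j N I) :=
  (measurableSet_F V U' j I).diff (measurableSet_upperPart V U' j N I)

variable {V U' j N I}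

theorem mem_F_zero {x : Fin d → ℝ} (hx : x ∈ F V I j U') : x 0 ∈ I.toSet := by
  obtain ⟨R, ⟨_, rfl, _⟩, hxR⟩ := mem_shadow.1 hx
  exact hxR 0 (mem_univ 0)

theorem update_mem_F {x : Fin d → ℝ} (hx : x ∈ F V I j U') {t : ℝ} (ht : t ∈ I.toSet) :
    update x 0 t ∈ F V I j U' := by
  obtain ⟨R, hR, hxR⟩ := mem_shadow.1 hx
  refine mem_shadow.2 ⟨R, hR, fun i _ => ?_⟩
  rcases eq_or_ne i 0 with rfl | hi
  · simpa [hR.2.1] using ht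
  · simpa [hi] using hxR i (mem_univ i)

/-- Every `J` that contributes to the upper part contains the ancestor `K` exactly `N` generations
above `I`. So the upper part is a cylinder over `K`, as `volume_inter_le_of_notMem_enlarge`
requires. -/
theorem update_mem_upperPart {K : DyadicInterval} (hIK : I.toSet ⊆ K.toSet)
    (hK : K.scale = I.scale + N) {z : Fin d → ℝ} (hz : z ∈ upperPart V U' j N I) {t : ℝ}
    (ht : t ∈ K.toSet) : update z 0 t ∈ upperPart V U' j N I := by
  obtain ⟨J, hJ, hzJ⟩ := mem_iUnion₂.1 hz
  refine mem_iUnion₂.2 ⟨J, hJ, update_mem_F hzJ ?_⟩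
  obtain ⟨s, hs⟩ := I.toSet_nonempty
  exact toSet_subset_of_inter ⟨s, hIK hs, hJ.1 hs⟩ (hK.trans_le hJ.2) ht

/-- The intervals I whose core contains x all contain `x 0`, hence are nested and determined by
their scale. One lying N or more generations above the smallest would put x in the upper part of the
smallest. So at most N scales occur. -/
theorem tsum_indicator_corePart_le (x : Fin d → ℝ) :
    ∑' I, (corePart V U' j N I).indicator (1 : (Fin d → ℝ) → ℝ≥0∞) x
      ≤ N * (shadow U').indicator 1 x := by
  classical
  rw [ENNReal.tsum_eq_iSup_sum]
  refine iSup_le fun t => ?_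
  set u := t.filter fun I => x ∈ corePart V U' j N I with hu
  have hsum : ∑ I ∈ t, (corePart V U' j N I).indicator (1 : (Fin d → ℝ) → ℝ≥0∞) x = u.card := by
    simp [indicator_apply, hu]
  rw [hsum]
  rcases u.eq_empty_or_nonempty with he | hne
  · rw [he]; simp
  obtain ⟨I₀, hI₀, hmin⟩ := u.exists_min_image scale hne
  have hmem : ∀ I ∈ u, x ∈ corePart V U' j N I := fun I hI => (Finset.mem_filter.1 hI).2
  have hx : x ∈ shadow U' := F_subset_shadow V U' j I₀ (hmem I₀ hI₀).1
  rw [indicator_of_mem hx, Pi.one_apply, mul_one]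
  have hcard : u.card ≤ (Finset.Ico I₀.scale (I₀.scale + N)).card := by
    refine Finset.card_le_card_of_injOn scale (fun I hI => ?_) fun I hI J hJ h =>
      eq_of_mem (mem_F_zero (hmem I hI).1) (mem_F_zero (hmem J hJ).1) h
    rw [Finset.mem_coe, Finset.mem_Ico]
    refine ⟨hmin I hI, ?_⟩
    by_contra! h
    refine (hmem I₀ hI₀).2 (mem_iUnion₂.2 ⟨I, ⟨?_, h⟩, (hmem I hI).1⟩)
    exact toSet_subset_of_inter ⟨x 0, mem_F_zero (hmem I₀ hI₀).1, mem_F_zero (hmem I hI).1⟩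
      (hmin I hI)
  rw [Int.card_Ico, add_sub_cancel_left, Int.toNat_natCast] at hcard
  exact_mod_cast hcard

end corePart

/-! ### Each rectangle meets its core in a fixed fraction -/

theorem exists_notMem_of_emb_lt {R : DyadicRect d} {V : Set (Fin d → ℝ)} {j : ℕ}
    (h : emb R V < 2 ^ j) : ∃ x, x 0 ∈ (R 0).dilate (2 ^ j) ∧ (∀ i, i ≠ 0 → x i ∈ (R i).toSet) ∧
      x ∉ V := by
  have hsub : ¬ R.dil (update 1 0 (2 ^ j)) ⊆ V := by
    intro hV
    refine h.not_ge ?_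
    have : ENNReal.ofReal (2 ^ j) ≤ emb R V :=
      le_iSup₂_of_le (f := fun (μ : ℝ) (_ : 1 ≤ μ ∧ R.dil (update 1 0 μ) ⊆ V) =>
        ENNReal.ofReal μ) (2 ^ j) ⟨one_le_pow₀ (by norm_num), hV⟩ le_rfl
    simpa [ENNReal.ofReal_pow] using this
  obtain ⟨x, hx, hxV⟩ := not_subset.1 hsub
  refine ⟨x, by simpa using hx 0 (mem_univ 0), fun i hi => ?_, hxV⟩
  have : x i ∈ (R i).dilate (update (1 : Fin d → ℝ) 0 (2 ^ j) i) := hx i (mem_univ i)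
  rwa [Function.update_of_ne hi, Pi.one_apply, dilate_one] at this

/-- Each rectangle of `F(I, j, U')` meets the core part of `F(I, j, U')` in a fixed fraction. -/
theorem mul_volume_le_volume_inter_corePart {η κ : ℝ} (hη : 0 < η) (hη1 : η < 1) {c : ℕ}
    (hc : 1 ≤ κ * 2 ^ c) {U U' : Set (DyadicRect d)} (hU : U' ⊆ U) {j : ℕ}
    {R : DyadicRect d} (hR : R ∈ U')
    (hj : (2 : ℝ≥0∞) ^ (j - 1) ≤ emb R (enlarge η (1 + κ) (shadow U)))
    (hj' : emb R (enlarge η (1 + κ) (shadow U)) < 2 ^ j) :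
    ENNReal.ofReal η * volume R.toSet ≤
      volume (R.toSet ∩ corePart (enlarge η (1 + κ) (shadow U)) U' j (j + c) (R 0)) := by
  set V := enlarge η (1 + κ) (shadow U) with hV
  set A := upperPart V U' j (j + c) (R 0) with hAd
  have hA : MeasurableSet A := measurableSet_upperPart _ _ _ _ _
  obtain ⟨x, hx0, hx, hxV⟩ := exists_notMem_of_emb_lt hj'
  obtain ⟨s, hs⟩ := (R 0).toSet_nonempty
  obtain ⟨K, hK, hsK⟩ := exists_mem ((R 0).scale + (j + c : ℕ)) s
  have hRK : (R 0).toSet ⊆ K.toSet := toSet_subset_of_inter ⟨s, hs, hsK⟩ (by rw [hK]; omega)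
  have hlen : K.length = 2 ^ j * 2 ^ c * (R 0).length := by
    rw [length, hK, zpow_add₀ two_ne_zero, zpow_natCast, pow_add, length]; ring
  -- The overhang of (1 + κ)K over K is governed by κ|K| = κ 2^c 2^j |R 0|, which is at least 2^j |R
  -- 0|.
  have hdil : (R 0).dilate (2 ^ j) ⊆ K.dilate (1 + κ) := by
    refine dilate_subset_dilate hRK ?_
    rw [hlen, add_sub_cancel_left]
    have h1 := (R 0).length_pos
    have h2 : (0 : ℝ) < 2 ^ j := by positivity
    calc ((2 : ℝ) ^ j - 1) * (R 0).length ≤ 2 ^ j * (R 0).length := by nlinarith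
      _ ≤ (κ * 2 ^ c) * (2 ^ j * (R 0).length) := le_mul_of_one_le_left (by positivity) hc
      _ = _ := by ring
  -- Only this inclusion ties U' to U in the density estimate, so one V, built from U, serves all
  -- U'.
  have hAU : A ⊆ shadow U := iUnion₂_subset fun J _ =>
    (F_subset_shadow V U' j J).trans (shadow_mono hU)
  have h := volume_inter_le_of_notMem_enlarge (measurableSet_shadow U) hA hAU hRK
    (fun z hz _ t ht => update_mem_upperPart hRK hK hz ht) (hdil hx0) hx hxV
  have hRF : R.toSet \ A ⊆ R.toSet ∩ corePart V U' j (j + c) (R 0) := fun y hy =>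
    ⟨hy.1, mem_shadow.2 ⟨R, ⟨hR, rfl, hj, hj'⟩, hy.1⟩, hy.2⟩
  refine le_trans ?_ (measure_mono hRF)
  have hsplit : volume R.toSet =
      ENNReal.ofReal (1 - η) * volume R.toSet + ENNReal.ofReal η * volume R.toSet := by
    rw [← add_mul, ← ENNReal.ofReal_add (by linarith) hη.le]
    simp
  have h2 : ENNReal.ofReal (1 - η) * volume R.toSet + ENNReal.ofReal η * volume R.toSet ≤
      ENNReal.ofReal (1 - η) * volume R.toSet + volume (R.toSet \ A) := by
    rw [← hsplit]
    calc volume R.toSet = volume (R.toSet ∩ A) + volume (R.toSet \ A) :=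
          (measure_inter_add_sdiff R.toSet hA).symm
      _ ≤ _ := by gcongr
  exact (ENNReal.add_le_add_iff_left
    (ENNReal.mul_ne_top ENNReal.ofReal_ne_top R.volume_toSet_ne_top)).1 h2

/-- The indicator of `F(I, j, U')` is controlled by the maximal function of the core part. -/
theorem indicator_F_le {η κ : ℝ} (hη : 0 < η) (hη1 : η < 1) {c : ℕ} (hc : 1 ≤ κ * 2 ^ c)
    {U U' : Set (DyadicRect d)} (hU : U' ⊆ U) (j : ℕ) (I : DyadicInterval) (x : Fin d → ℝ) :
    (F (enlarge η (1 + κ) (shadow U)) I j U').indicator 1 x ≤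
      (2 ^ d / ENNReal.ofReal η) ^ 2 * iterMax balls (List.finRange d)
        ((corePart (enlarge η (1 + κ) (shadow U)) U' j (j + c) I).indicator 1) x ^ 2 := by
  set V := enlarge η (1 + κ) (shadow U) with hV
  by_cases hx : x ∈ F V I j U'
  swap
  · rw [indicator_of_notMem hx]; exact zero_le
  rw [indicator_of_mem hx, ← mul_pow]
  refine one_le_pow₀ ?_
  obtain ⟨R, ⟨hR, rfl, hj, hj'⟩, hxR⟩ := mem_shadow.1 hx
  have hvol := mul_volume_le_volume_inter_corePart hη hη1 hc hU hR hj hj'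
  set E := corePart V U' j (j + c) (R 0) with hEd
  have hE : MeasurableSet E := measurableSet_corePart _ _ _ _ _
  have hint := setLIntegral_pi_le_iterMax measurableSet_balls (R := fun i => (R i).toSet)
    (c := fun i => 2 * volume (R i).toSet) (fun i f t ht => by
      have h := setLIntegral_le_setMax_balls
        (a := (R i).pos * 2 ^ (R i).scale) (b := ((R i).pos + 1) * 2 ^ (R i).scale)
        (by have := (R i).length_pos; unfold length at this; nlinarith)
        Ico_subset_Icc_self f ht
      refine h.trans_eq ?_
      rw [DyadicInterval.volume_toSet, length, ENNReal.ofReal_mul (by norm_num)]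
      simp; ring_nf)
    (measurable_one.indicator hE) hxR
  rw [lintegral_indicator_one hE, Measure.restrict_apply hE, Finset.prod_mul_distrib,
    ← R.volume_toSet, inter_comm] at hint
  have h := hvol.trans hint
  set M := iterMax balls (List.finRange d) (E.indicator 1) x
  -- The loss 2^d arises from replacing each side of `R` by a rational interval at most twice as
  -- long.
  have h2 : ENNReal.ofReal η ≤ 2 ^ d * M := by
    refine (ENNReal.mul_le_mul_iff_left R.volume_toSet_ne_zero R.volume_toSet_ne_top).1
      (h.trans_eq ?_)
    simp; ring
  have hη0 : ENNReal.ofReal η ≠ 0 := by simpa using hη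
  calc (1 : ℝ≥0∞) = ENNReal.ofReal η / ENNReal.ofReal η :=
        (ENNReal.div_self hη0 ENNReal.ofReal_ne_top).symm
    _ ≤ 2 ^ d * M / ENNReal.ofReal η := ENNReal.div_le_div_right h2 _
    _ = _ := by rw [div_eq_mul_inv, div_eq_mul_inv]; ring

/-- One factor 1 + κ pays for the level set and the other for the dilation. -/
theorem volume_enlarge_le {η κ : ℝ} (hκ : 0 < κ) {E : Set (Fin d → ℝ)} (hE : MeasurableSet E)
    (h : volume (levelSet η E) ≤ ENNReal.ofReal (1 + κ) * volume E) :
    volume (enlarge η (1 + κ) E) ≤ ENNReal.ofReal ((1 + κ) * (1 + κ)) * volume E := by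
  have h1 := mul_volume_densitySet_le (0 : Fin d) (τ := 1 + κ) (by linarith) ENNReal.one_ne_top
    (measurableSet_levelSet η hE)
  rw [one_mul] at h1
  refine h1.trans ((mul_le_mul_right h _).trans_eq ?_)
  rw [ENNReal.ofReal_mul (by linarith), mul_assoc]

/-! ### Choice of constants and the common L^p bound -/

/-- The factor `j + 1 + c` is the overlap of the cores at index `j + 1`. Its linear growth is
absorbed by the geometric weight. -/
theorem tsum_weight_ne_top {ε : ℝ} (hε : 0 < ε) (c : ℕ) :
    ∑' j : ℕ, (2 : ℝ≥0∞) ^ (-ε * ((j + 1 : ℕ) : ℝ)) * ((j + 1 + c : ℕ) : ℝ≥0∞) ≠ ∞ := by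
  set r : ℝ := 2 ^ (-ε) with hr
  have hr0 : 0 < r := by positivity
  have hr1 : r < 1 := Real.rpow_lt_one_of_one_lt_of_neg (by norm_num) (by linarith)
  have hterm : ∀ j : ℕ, (2 : ℝ≥0∞) ^ (-ε * ((j + 1 : ℕ) : ℝ)) * ((j + 1 + c : ℕ) : ℝ≥0∞) =
      ENNReal.ofReal (r ^ (j + 1) * ((j + 1 + c : ℕ) : ℝ)) := by
    intro j
    rw [ENNReal.ofReal_mul (by positivity), ENNReal.ofReal_natCast, hr, ← Real.rpow_natCast,
      ← Real.rpow_mul (by norm_num), ← ENNReal.ofReal_rpow_of_pos (by norm_num)]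
    simp
  simp only [hterm]
  have hnorm : ‖r‖ < 1 := by rwa [Real.norm_of_nonneg hr0.le]
  have h1 := summable_pow_mul_geometric_of_norm_lt_one 1 hnorm
  have h2 := (summable_geometric_of_lt_one hr0.le hr1).mul_left (1 + c : ℝ)
  have hsum : Summable fun j : ℕ => r ^ (j + 1) * ((j + 1 + c : ℕ) : ℝ) := by
    refine ((h1.add h2).mul_left r).congr fun j => ?_
    push_cast; ring
  exact hsum.tsum_ofReal_ne_top

theorem exists_vector_valued_const {d : ℕ} (l : List (Fin d)) : ∃ D : ℝ → ℝ≥0, ∀ p, 1 ≤ p →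
    ∀ {ι : Type} [Countable ι] (a : ι → ℝ≥0∞) (f : ι → (Fin d → ℝ) → ℝ≥0∞),
      (∀ k, Measurable (f k)) → ∫⁻ x, (∑' k, a k * iterMax balls l (f k) x ^ 2) ^ p
        ≤ D p * ∫⁻ x, (∑' k, a k * f k x ^ 2) ^ p := by
  have h : ∀ p : ℝ, ∃ D : ℝ≥0, 1 ≤ p → ∀ {ι : Type} [Countable ι] (a : ι → ℝ≥0∞)
      (f : ι → (Fin d → ℝ) → ℝ≥0∞), (∀ k, Measurable (f k)) →
      ∫⁻ x, (∑' k, a k * iterMax balls l (f k) x ^ 2) ^ p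
        ≤ D * ∫⁻ x, (∑' k, a k * f k x ^ 2) ^ p := by
    intro p
    by_cases hp : 1 ≤ p
    · obtain ⟨D, hD⟩ := vector_valued hp l
      exact ⟨D, fun _ => hD⟩
    -- A dummy value: nothing is claimed for p < 1.
    · exact ⟨0, fun h => absurd h hp⟩
  choose D hD using h
  exact ⟨D, hD⟩

/-- The common `L ^ p` bound, `p ≥ 1`, for the indicators of the sets `F(I, j, U')`. -/
theorem exists_enlargement (d : ℕ) [NeZero d] (δ ε : ℝ) (hδ : 0 < δ) (hε : 0 < ε) :
    ∃ C : ℝ → ℝ≥0, ∀ U : Set (DyadicRect d), ∃ V : Set (Fin d → ℝ), MeasurableSet V ∧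
      shadow U ⊆ V ∧ volume V ≤ (1 + ENNReal.ofReal δ) * volume (shadow U) ∧
      ∀ U' ⊆ U, ∀ p : ℝ, 1 ≤ p →
        ∫⁻ x, (∑' k : ℕ × DyadicInterval, (2 : ℝ≥0∞) ^ (-ε * ((k.1 + 1 : ℕ) : ℝ)) *
          (F V k.2 (k.1 + 1) U').indicator 1 x) ^ p ≤ C p * volume (shadow U') := by
  obtain ⟨κ, hκ, hκδ⟩ : ∃ κ : ℝ, 0 < κ ∧ (1 + κ) * (1 + κ) ≤ 1 + δ := by
    refine ⟨min δ 1 / 3, by positivity, ?_⟩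
    have h1 := min_le_left δ 1
    have h2 := min_le_right δ 1
    have h3 : 0 < min δ 1 := by positivity
    nlinarith
  obtain ⟨c, hc⟩ : ∃ c : ℕ, 1 ≤ κ * 2 ^ c := by
    obtain ⟨c, hc⟩ := pow_unbounded_of_one_lt (1 / κ) (one_lt_two)
    refine ⟨c, ?_⟩
    rw [div_lt_iff₀ hκ] at hc
    linarith
  obtain ⟨η, hη0, hη1, hη⟩ := exists_volume_iterMax_le (tailCoords d) hκ
  obtain ⟨D, hD⟩ := exists_vector_valued_const (List.finRange d)
  set S : ℝ≥0∞ := ∑' j : ℕ, (2 : ℝ≥0∞) ^ (-ε * ((j + 1 : ℕ) : ℝ)) * ((j + 1 + c : ℕ) : ℝ≥0∞)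
    with hSd
  have hS : S ≠ ∞ := tsum_weight_ne_top hε c
  set B : ℝ≥0∞ := (2 ^ d / ENNReal.ofReal η) ^ 2 with hBd
  have hB : B ≠ ∞ := ENNReal.pow_ne_top (ENNReal.div_ne_top (by simp) (by simpa using hη0))
  -- `B` is the loss in passing from F to its core, `D p` the vector valued constant, and `S` the
  -- weighted total overlap of the cores.
  refine ⟨fun p => (B ^ p * (D p * S ^ p)).toNNReal, fun U =>
    ⟨enlarge η (1 + κ) (shadow U), measurableSet_densitySet _ _ _
      (measurableSet_levelSet _ (measurableSet_shadow U)),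
      shadow_subset_enlarge hη0 (by linarith) U, ?_, fun U' hU p hp => ?_⟩⟩
  · refine (volume_enlarge_le hκ (measurableSet_shadow U) (hη _ (measurableSet_shadow U))).trans ?_
    rw [← ENNReal.ofReal_one, ← ENNReal.ofReal_add zero_le_one hδ.le]
    gcongr
  have hp0 : 0 < p := by linarith
  rw [ENNReal.coe_toNNReal (ENNReal.mul_ne_top (ENNReal.rpow_ne_top_of_nonneg hp0.le hB)
    (ENNReal.mul_ne_top ENNReal.coe_ne_top (ENNReal.rpow_ne_top_of_nonneg hp0.le hS)))]
  set V := enlarge η (1 + κ) (shadow U) with hV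
  set a : ℕ × DyadicInterval → ℝ≥0∞ := fun k => 2 ^ (-ε * ((k.1 + 1 : ℕ) : ℝ)) with ha
  set f : ℕ × DyadicInterval → (Fin d → ℝ) → ℝ≥0∞ := fun k =>
    (corePart V U' (k.1 + 1) (k.1 + 1 + c) k.2).indicator 1 with hf
  have hfm : ∀ k, Measurable (f k) := fun k =>
    measurable_one.indicator (measurableSet_corePart _ _ _ _ _)
  have hover : ∀ x, ∑' k, a k * f k x ^ 2 ≤ S * (shadow U').indicator 1 x := by
    intro x
    calc ∑' k, a k * f k x ^ 2 = ∑' k, a k * f k x := by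
          refine tsum_congr fun k => ?_
          by_cases hx : x ∈ corePart V U' (k.1 + 1) (k.1 + 1 + c) k.2 <;> simp [hf, hx]
      _ = ∑' j : ℕ, (2 : ℝ≥0∞) ^ (-ε * ((j + 1 : ℕ) : ℝ)) * ∑' I : DyadicInterval,
            (corePart V U' (j + 1) (j + 1 + c) I).indicator (1 : (Fin d → ℝ) → ℝ≥0∞) x := by
          rw [ENNReal.tsum_prod']
          refine tsum_congr fun j => ?_
          rw [← ENNReal.tsum_mul_left]
      _ ≤ ∑' j : ℕ, (2 : ℝ≥0∞) ^ (-ε * ((j + 1 : ℕ) : ℝ)) *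
            (((j + 1 + c : ℕ) : ℝ≥0∞) * (shadow U').indicator 1 x) :=
          ENNReal.tsum_le_tsum fun j => mul_le_mul_right (tsum_indicator_corePart_le x) _
      _ = _ := by
          simp only [← mul_assoc]
          rw [ENNReal.tsum_mul_right]
  calc ∫⁻ x, (∑' k, a k * (F V k.2 (k.1 + 1) U').indicator 1 x) ^ p
      ≤ ∫⁻ x, (B * ∑' k, a k * iterMax balls (List.finRange d) (f k) x ^ 2) ^ p := by
        refine lintegral_mono fun x => ENNReal.rpow_le_rpow ?_ hp0.le
        rw [← ENNReal.tsum_mul_left]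
        refine ENNReal.tsum_le_tsum fun k => ?_
        rw [mul_left_comm]
        exact mul_le_mul_right (indicator_F_le hη0 hη1 hc hU (k.1 + 1) k.2 x) _
    _ = B ^ p * ∫⁻ x, (∑' k, a k * iterMax balls (List.finRange d) (f k) x ^ 2) ^ p := by
        rw [← lintegral_const_mul' _ _ (ENNReal.rpow_ne_top_of_nonneg hp0.le hB)]
        exact lintegral_congr fun x => ENNReal.mul_rpow_of_nonneg _ _ hp0.le
    _ ≤ B ^ p * (D p * ∫⁻ x, (∑' k, a k * f k x ^ 2) ^ p) :=
        mul_le_mul_right (hD p hp a f hfm) _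
    _ ≤ B ^ p * (D p * ∫⁻ x, S ^ p * (shadow U').indicator 1 x) := by
        refine mul_le_mul_right (mul_le_mul_right (lintegral_mono fun x => ?_) _) _
        refine (ENNReal.rpow_le_rpow (hover x) hp0.le).trans_eq ?_
        by_cases hx : x ∈ shadow U' <;> simp [hx, hp0]
    _ = _ := by
        rw [lintegral_const_mul' _ _ (ENNReal.rpow_ne_top_of_nonneg hp0.le hS),
          lintegral_indicator_one (measurableSet_shadow U')]
        ring

end Journe

/-- The index `j` of the sums over `j ≥ 1` is written `j + 1` with `j : ℕ`. `C` depends only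
on `d, δ, ε` and `Cp p` only on `d, δ, ε, p`; `V` depends only on `d, δ, ε, U`. -/
theorem lemmal (d : ℕ) [NeZero d] (δ ε : ℝ) (hδ : 0 < δ) (hε : 0 < ε) :
    ∃ (C : ℝ≥0) (Cp : ℝ → ℝ≥0),
      ∀ U : Set (Journe.DyadicRect d), volume (Journe.shadow U) < ∞ →
        ∃ V : Set (Fin d → ℝ), MeasurableSet V ∧ Journe.shadow U ⊆ V ∧
          volume V ≤ (1 + ENNReal.ofReal δ) * volume (Journe.shadow U) ∧
          ∀ U' : Set (Journe.DyadicRect d), U' ⊆ U →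
            (∑' (j : ℕ) (I : Journe.DyadicInterval),
                (2 : ℝ≥0∞) ^ (-ε * ((j + 1 : ℕ) : ℝ)) * volume (Journe.F V I (j + 1) U')
              ≤ C * volume (Journe.shadow U')) ∧
            ∀ n : ℕ, 1 < n → ∀ p : ℝ, 1 < p →
              eLpNorm (fun x : Fin d → ℝ => ∑' (j : ℕ) (I : Journe.DyadicInterval),
                  (2 : ℝ≥0∞) ^ (-ε * ((j + 1 : ℕ) : ℝ)) *
                    Journe.strongMaximal
                      ((Journe.F V I (j + 1) U').indicator fun _ => (1 : ℝ)) x ^ n)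
                (ENNReal.ofReal p) volume
              ≤ Cp p * volume (Journe.shadow U') ^ (1 / p) := by
  obtain ⟨K, hK⟩ := Journe.exists_enlargement d δ ε hδ hε
  obtain ⟨D, hD⟩ := Journe.exists_vector_valued_const (List.finRange d)
  -- The first bound is the case p = 1 of `exists_enlargement`. In the second, 4^d dominates the
  -- strong maximal function by the iterated one, `D p` removes the latter, and `K p` bounds the
  -- remaining sum of indicators.
  refine ⟨K 1, fun p => ((4 ^ d : ℝ≥0) ^ p * (D p * K p)) ^ (1 / p), fun U _ => ?_⟩
  obtain ⟨V, hVm, hUV, hV, hmain⟩ := hK U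
  refine ⟨V, hVm, hUV, hV, fun U' hU => ⟨?_, fun n hn p hp => ?_⟩⟩
  · have h := hmain U' hU 1 le_rfl
    simp only [ENNReal.rpow_one] at h
    rw [lintegral_tsum fun k => ((measurable_one.indicator
      (Journe.measurableSet_F _ _ _ _)).const_mul _).aemeasurable, ENNReal.tsum_prod'] at h
    refine le_of_eq_of_le (tsum_congr fun j => tsum_congr fun I => ?_) h
    rw [lintegral_const_mul _ (measurable_one.indicator (Journe.measurableSet_F _ _ _ _)),
      lintegral_indicator_one (Journe.measurableSet_F _ _ _ _)]
  · have hp0 : 0 < p := by linarith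
    let a : ℕ × Journe.DyadicInterval → ℝ≥0∞ := fun k => 2 ^ (-ε * ((k.1 + 1 : ℕ) : ℝ))
    let f : ℕ × Journe.DyadicInterval → (Fin d → ℝ) → ℝ≥0∞ := fun k =>
      (Journe.F V k.2 (k.1 + 1) U').indicator 1
    have hfm : ∀ k, Measurable (f k) := fun k =>
      measurable_one.indicator (Journe.measurableSet_F _ _ _ _)
    have h4 : ((4 : ℝ≥0∞) ^ d) ^ p ≠ ∞ := ENNReal.rpow_ne_top_of_nonneg hp0.le (by simp)
    rw [eLpNorm_eq_lintegral_rpow_enorm_toReal (by simpa using hp0) ENNReal.ofReal_ne_top,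
      ENNReal.toReal_ofReal hp0.le]
    beta_reduce
    rw [ENNReal.coe_rpow_of_nonneg _ (by positivity),
      ← ENNReal.mul_rpow_of_nonneg _ _ (by positivity)]
    refine ENNReal.rpow_le_rpow ?_ (by positivity)
    simp only [enorm_eq_self]
    calc _ ≤ ∫⁻ x, (4 ^ d * ∑' k, a k *
            Journe.iterMax Journe.balls (List.finRange d) (f k) x ^ 2) ^ p := by
          refine lintegral_mono fun x => ENNReal.rpow_le_rpow ?_ hp0.le
          rw [← ENNReal.tsum_mul_left, ENNReal.tsum_prod']
          refine ENNReal.tsum_le_tsum fun j => ENNReal.tsum_le_tsum fun I => ?_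
          rw [mul_left_comm]
          exact mul_le_mul_right (Journe.strongMaximal_indicator_pow_le
            (Journe.measurableSet_F _ _ _ _) hn x) _
      _ = (4 ^ d) ^ p * ∫⁻ x, (∑' k, a k *
            Journe.iterMax Journe.balls (List.finRange d) (f k) x ^ 2) ^ p := by
          rw [← lintegral_const_mul' _ _ h4]
          exact lintegral_congr fun x => ENNReal.mul_rpow_of_nonneg _ _ hp0.le
      _ ≤ (4 ^ d) ^ p * (D p * ∫⁻ x, (∑' k, a k * f k x ^ 2) ^ p) :=
          mul_le_mul_right (hD p hp.le a f hfm) _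
      -- Indicators equal their squares, so `exists_enlargement` applies to the sum.
      _ = (4 ^ d) ^ p * (D p * ∫⁻ x, (∑' k, a k * f k x) ^ p) := by
          congr 2
          refine lintegral_congr fun x => ?_
          congr 1
          refine tsum_congr fun k => ?_
          by_cases hx : x ∈ Journe.F V k.2 (k.1 + 1) U' <;> simp [f, hx]
      _ ≤ (4 ^ d) ^ p * (D p * (K p * volume (Journe.shadow U'))) := by
          gcongr
          exact hmain U' hU p hp.le
      _ = _ := by
          rw [ENNReal.coe_mul, ENNReal.coe_mul, ENNReal.coe_rpow_of_nonneg _ hp0.le,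
            ENNReal.coe_pow, ENNReal.coe_ofNat, mul_assoc, mul_assoc]
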